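/- Let $F$ be a number field with ring of integers $\mathcal O_F$, let $m, N\ge 0$ and $d\ge 1$ be integers, and let $f_1,\dots,f_m\in\mathcal O_F[X_0,\dots,X_N]$ be homogeneous polynomials, all of the same degree $d$, which define a smooth complete intersection $V\subset\mathbf P^N_F$ of codimension $m$; that is, at every point $x\in\overline F^{\,N+1}\setminus\{0\}$ with $f_1(x)=\dots=f_m(x)=0$ the gradients of $f_1,\dots,f_m$ are linearly independent. Assume $\delta:=N+1-md\ge 1$. Write $\boldsymbol f=(f_1,\dots,f_m)$, and let $W=\{x\in\mathbf A^{N+1}_F\setminus\{0\} : \boldsymbol f(x)=0\}$ be the cone above $V$, which has dimension $\dim W=N+1-m$. Let $\mathfrak p$ be a finite place of $F$, with completion $F_{\mathfrak p}$, ring of integers $\mathcal O_{\mathfrak p}$, residue field $\mathbf F_{\mathfrak p}$ and normalized absolute value $|\cdot|_{\mathfrak p}$ (a uniformizer has absolute value $1/\#\mathbf F_{\mathfrak p}$). Let $dx$ be the Haar measure on $F_{\mathfrak p}$ normalized by $\int_{\mathcal O_{\mathfrak p}}dx=1$. Let $\boldsymbol\omega_{L,\mathfrak p}$ be the measure on $W(F_{\mathfrak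 p})$ given by the Leray form, which up to sign is $$\Bigl(\det\Bigl(\frac{\partial f_i}{\partial X_{k_j}}\Bigr)_{1\le i,j\le m}\Bigr)^{-1}\,dX_0\wedge\dots\wedge\widehat{dX_{k_j}}\wedge\dots\wedge dX_N$$ on the locus where this minor does not vanish, for $0\le k_1<\dots<k_m\le N$ (these local expressions agree on overlaps, up to sign): where the coordinates $x_l$ with $l\notin\{k_1,\dots,k_m\}$ are local coordinates, $\boldsymbol\omega_{L,\mathfrak p}$ is $\bigl|\det(\partial f_i/\partial X_{k_j})\bigr|_{\mathfrak p}^{-1}\prod_{l\notin\{k_1,\dots,k_m\}}dx_l$. Then $\{x\in W(F_{\mathfrak p}) : x\in\mathcal O_{\mathfrak p}^{N+1}\}$ has finite measure, the limit below exists, and $$\int_{\{x\in\mathcal O_{\mathfrak p}^{N+1}\,\mid\,x\ne 0,\ \boldsymbol f(x)=0\}}\boldsymbol\omega_{L,\mathfrak p}=\lim_{r\to+\infty}\frac{\#\{x\in(\mathcal O_{\mathfrak p}/\mathfrak p^r)^{N+1}\mid \boldsymbol f(x)=0\text{ in }(\mathcal O_{\mathfrak p}/\mathfrak p^r)^m\}}{(\#\mathbf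 F_{\mathfrak p})^{r\dim W}}.$$ -/

import Mathlib

open MeasureTheory Filter Topology
open scoped ENNReal NumberField

namespace LerayDensity

section Cone

variable {R : Type*} [CommRing R] {m N : ℕ}

/-- The homogeneous polynomials `f i` of positive degree in the variables `X_0, …, X_N` over a ring `R` mapping to a field `F`, cut out a smooth complete intersection of
codimension `m` in `ℙ^N` over `F`: at every geometric point of their common zero locus the
`m` gradient vectors of the `f i` are linearly independent. -/
def IsSmoothCompleteIntersection (F : Type*) [Field F] [Algebra R F]
    (f : Fin m → MvPolynomial (Fin (N + 1)) R) : Prop :=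
  ∀ x : Fin (N + 1) → AlgebraicClosure F, x ≠ 0 →
    (∀ i, MvPolynomial.aeval x (f i) = 0) →
    LinearIndependent (AlgebraicClosure F)
      (fun i : Fin m => fun j : Fin (N + 1) =>
        MvPolynomial.aeval x (MvPolynomial.pderiv j (f i)))

/-- The `K`-points `W(K)` of the punctured affine cone
`W = {x ∈ 𝔸^{N+1} ∖ {0} : f_1(x) = ⋯ = f_m(x) = 0}`. -/
def coneSet (K : Type*) [Field K] [Algebra R K]
    (f : Fin m → MvPolynomial (Fin (N + 1)) R) : Set (Fin (N + 1) → K) :=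
  {x | x ≠ 0 ∧ ∀ i, MvPolynomial.aeval x (f i) = 0}

/-- The Jacobian minor `det (∂f_i / ∂X_{k_j})_{1 ≤ i, j ≤ m}` at `x`, for a choice of columns
`k_1 < ⋯ < k_m`. -/
noncomputable def minor {K : Type*} [Field K] [Algebra R K]
    (f : Fin m → MvPolynomial (Fin (N + 1)) R) (k : Fin m ↪o Fin (N + 1))
    (x : Fin (N + 1) → K) : K :=
  Matrix.det (Matrix.of fun i j : Fin m =>
    MvPolynomial.aeval x (MvPolynomial.pderiv (k j) (f i)))

/-- The projection forgetting the coordinates `x_{k_1}, …, x_{k_m}`. Where the minor of `k` does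
not vanish, it is a local coordinate system on the cone. -/
def dropCoords {K : Type*} (k : Fin m ↪o Fin (N + 1)) (x : Fin (N + 1) → K) :
    {j : Fin (N + 1) // j ∉ Set.range k} → K :=
  fun j => x j

variable {K : Type*} [NormedField K] [Algebra R K]

/-- The points of the cone at which the chart given by `k` is used: the minor of `k` is nonzero
and has the largest absolute value among all minors of size `m` of the Jacobian matrix, ties being
broken by the lexicographic order. These pieces are pairwise disjoint and cover the locus of the
cone where the Jacobian matrix has rank `m`. -/
def chartPiece (f : Fin m → MvPolynomial (Fin (N + 1)) R) (k : Fin m ↪o Fin (N + 1)) :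
    Set (coneSet K f) :=
  {x | minor f k x.1 ≠ 0 ∧ ∀ k' : Fin m ↪o Fin (N + 1),
    ‖minor f k' x.1‖ < ‖minor f k x.1‖ ∨
      (‖minor f k' x.1‖ = ‖minor f k x.1‖ ∧
        toLex (k : Fin m → Fin (N + 1)) ≤ toLex (k' : Fin m → Fin (N + 1)))}

variable [MeasurableSpace K]

/-- For a point `y` of the coordinate space of the chart `k`, the sum of the point masses at the
points of the chart piece lying over `y`, weighted with the density
`|det (∂f_i / ∂X_{k_j})|⁻¹` of the Leray form. -/
noncomputable def lerayFibre (f : Fin m → MvPolynomial (Fin (N + 1)) R)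
    (k : Fin m ↪o Fin (N + 1)) (y : {j : Fin (N + 1) // j ∉ Set.range k} → K) :
    Measure (coneSet K f) :=
  Measure.sum fun x : {x : coneSet K f // x ∈ chartPiece f k ∧ dropCoords k x.1 = y} =>
    ENNReal.ofReal ‖minor f k x.1.1‖⁻¹ • Measure.dirac x.1

/-- The measure on `W(K)` given, with respect to the measure `μ` on `K`, by the Leray form, i.e.
by the differential form which is locally
`± (det (∂f_i / ∂X_{k_j}))⁻¹ dX_0 ∧ ⋯ ∧ (omit dX_{k_1}, …, dX_{k_m}) ∧ ⋯ ∧ dX_N`.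
The expressions for different `k` agree where both make sense, so the measure is obtained by
integrating on each piece of a partition of `W(K)` the expression for one chart `k` defined on
that piece: the part of a set `A` in the piece of `k` has measure
`∫ ∑_{x ∈ A in the piece, x ↦ y} |det (∂f_i / ∂X_{k_j})(x)|⁻¹ ∏_j dμ(y_j)`. -/
noncomputable def lerayMeasure (f : Fin m → MvPolynomial (Fin (N + 1)) R) (μ : Measure K) :
    Measure (coneSet K f) :=
  Measure.sum fun k : Fin m ↪o Fin (N + 1) =>
    Measure.bind (Measure.pi fun _ : {j : Fin (N + 1) // j ∉ Set.range k} => μ) (lerayFibre f k)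

end Cone

section Measurability

open Set

variable {R : Type*} [CommRing R] {m N : ℕ} {K : Type*} [NontriviallyNormedField K]
  [Algebra R K]

/-- The derivative of a polynomial map is given by the formal partial derivatives. -/
theorem hasStrictFDerivAt_aeval (p : MvPolynomial (Fin (N + 1)) R) (x : Fin (N + 1) → K) :
    HasStrictFDerivAt (fun x : Fin (N + 1) → K => MvPolynomial.aeval x p)
      (∑ j, MvPolynomial.aeval x (MvPolynomial.pderiv j p) •
        (ContinuousLinearMap.proj j : (Fin (N + 1) → K) →L[K] K)) x := by
  induction p using MvPolynomial.induction_on with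
  | C a =>
    simp only [MvPolynomial.aeval_C]
    refine (hasStrictFDerivAt_const (𝕜 := K) (algebraMap R K a) x).congr_fderiv ?_
    ext z
    simp
  | add p q hp hq =>
    have h := hp.add hq
    simp only [map_add]
    refine h.congr_fderiv ?_
    ext z
    simp [add_mul, Finset.sum_add_distrib]
  | mul_X p i hp =>
    have h := hp.mul
      (ContinuousLinearMap.proj (R := K) (φ := fun _ : Fin (N + 1) => K) i).hasStrictFDerivAt
    simp only [map_mul, MvPolynomial.aeval_X]
    refine h.congr_fderiv ?_
    ext z
    have h2 : ∀ j, MvPolynomial.aeval x (MvPolynomial.pderiv j (p * MvPolynomial.X i)) * z j =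
        x i * (MvPolynomial.aeval x (MvPolynomial.pderiv j p) * z j) +
          (if i = j then MvPolynomial.aeval x p * z j else 0) := by
      intro j
      rw [MvPolynomial.pderiv_mul, MvPolynomial.pderiv_X]
      by_cases h1 : i = j
      · subst h1; simp; ring
      · rw [Pi.single_eq_of_ne h1]; simp [h1]; ring
    rw [sum_apply]
    simp only [smul_apply, smul_eq_mul, ContinuousLinearMap.proj_apply, h2]
    simp [Finset.sum_add_distrib, Finset.mul_sum, add_comm]

theorem continuous_aeval_point (p : MvPolynomial (Fin (N + 1)) R) :
    Continuous (fun x : Fin (N + 1) → K => MvPolynomial.aeval x p) :=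
  continuous_iff_continuousAt.2 fun x => (hasStrictFDerivAt_aeval p x).continuousAt

theorem continuous_minor (f : Fin m → MvPolynomial (Fin (N + 1)) R) (k : Fin m ↪o Fin (N + 1)) :
    Continuous (minor (K := K) f k) := by
  unfold minor
  apply Continuous.matrix_det
  exact continuous_matrix fun i j => continuous_aeval_point _

variable [CompleteSpace K]

/-- Where the minor of `k` does not vanish, the projection `dropCoords k` is locally injective on
the cone. -/
theorem exists_injOn (f : Fin m → MvPolynomial (Fin (N + 1)) R) (k : Fin m ↪o Fin (N + 1))
    (x : coneSet K f) (hx : minor f k x.1 ≠ 0) :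
    ∃ U ∈ 𝓝 x, InjOn (fun y : coneSet K f => dropCoords k y.1) U := by
  let f' : (Fin (N + 1) → K) →L[K] (Fin m → K) := ContinuousLinearMap.pi fun i =>
    ∑ j, MvPolynomial.aeval x.1 (MvPolynomial.pderiv j (f i)) •
        (ContinuousLinearMap.proj j : (Fin (N + 1) → K) →L[K] K)
  let g : (Fin (N + 1) → K) → (Fin m → K) := fun x i => MvPolynomial.aeval x (f i)
  have hg : HasStrictFDerivAt g f' x.1 :=
    hasStrictFDerivAt_pi.2 fun i => hasStrictFDerivAt_aeval (f i) x.1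
  let D : (Fin (N + 1) → K) →L[K] ({j : Fin (N + 1) // j ∉ Set.range k} → K) :=
    ContinuousLinearMap.pi fun j => ContinuousLinearMap.proj j.1
  have hker : LinearMap.ker (f'.prod D).toLinearMap = ⊥ := by
    rw [LinearMap.ker_eq_bot']
    intro z hz
    have hz1 : f' z = 0 := congrArg Prod.fst hz
    have hz2 : ∀ j, j ∉ Set.range k → z j = 0 := fun j hj =>
      congrFun (congrArg Prod.snd hz) ⟨j, hj⟩
    have hJ : (Matrix.of fun i j : Fin m =>
        MvPolynomial.aeval x.1 (MvPolynomial.pderiv (k j) (f i))).mulVec (z ∘ k) = 0 := by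
      funext i
      have := congrFun hz1 i
      simp only [f', ContinuousLinearMap.coe_pi', sum_apply,
        smul_apply, ContinuousLinearMap.proj_apply, smul_eq_mul] at this
      simp only [Matrix.mulVec, dotProduct, Matrix.of_apply, Function.comp]
      rw [← this]
      rw [← Finset.sum_image (f := fun j => MvPolynomial.aeval x.1 (MvPolynomial.pderiv j (f i)) * z j)
        (g := fun j => k j) (s := Finset.univ) k.injective.injOn]
      apply Finset.sum_subset (Finset.subset_univ _)
      intro j _ hj
      rw [hz2 j (by simpa using hj), mul_zero]
    have := Matrix.eq_zero_of_mulVec_eq_zero hx hJ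
    funext j
    by_cases hj : j ∈ Set.range k
    · obtain ⟨a, rfl⟩ := hj
      exact congrFun this a
    · exact hz2 j hj
  obtain ⟨C, hC, hanti⟩ := LinearMap.exists_antilipschitzWith _ hker
  obtain ⟨s, hs, happ⟩ := hg.approximates_deriv_on_nhds (c := (2 * C)⁻¹)
    (Or.inr (by positivity))
  refine ⟨(↑) ⁻¹' s, continuous_subtype_val.continuousAt.preimage_mem_nhds hs, ?_⟩
  intro y hy z hz hyz
  apply Subtype.ext
  have h0 : g y.1 - g z.1 = 0 := by
    funext i
    simp [g, y.2.2 i, z.2.2 i]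
  have h1 := happ y.1 hy z.1 hz
  rw [h0, zero_sub, norm_neg] at h1
  have h2 := hanti.le_mul_dist y.1 z.1
  have hD : D y.1 = D z.1 := hyz
  have h3 : dist ((f'.prod D).toLinearMap y.1) ((f'.prod D).toLinearMap z.1)
      = ‖f' (y.1 - z.1)‖ := by
    rw [dist_eq_norm, ← map_sub]
    have : (f'.prod D).toLinearMap (y.1 - z.1) = (f' (y.1 - z.1), 0) := by
      simp [hD]
    rw [this, Prod.norm_mk]; simp
  rw [h3, dist_eq_norm] at h2
  have hC' : (0 : ℝ) < C := by exact_mod_cast hC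
  have h4 : (C : ℝ) * ‖f' (y.1 - z.1)‖ ≤ 2⁻¹ * ‖y.1 - z.1‖ := by
    calc (C : ℝ) * ‖f' (y.1 - z.1)‖ ≤ C * (((2 * C)⁻¹ : NNReal) * ‖y.1 - z.1‖) := by gcongr
      _ = 2⁻¹ * ‖y.1 - z.1‖ := by push_cast; field_simp
  have h5 : ‖y.1 - z.1‖ = 0 := le_antisymm (by linarith) (norm_nonneg _)
  exact sub_eq_zero.1 (norm_eq_zero.1 h5)

variable [MeasurableSpace K] [BorelSpace K] [SecondCountableTopology K]

theorem measurableSet_coneSet (f : Fin m → MvPolynomial (Fin (N + 1)) R) :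
    MeasurableSet (coneSet K f) := by
  unfold coneSet
  have : {x : Fin (N + 1) → K | x ≠ 0 ∧ ∀ i, MvPolynomial.aeval x (f i) = 0}
    = {0}ᶜ ∩ ⋂ i, {x | MvPolynomial.aeval x (f i) = 0} := by ext; simp
  rw [this]
  exact (measurableSet_singleton _).compl.inter (MeasurableSet.iInter fun i =>
    (isClosed_eq (continuous_aeval_point _) continuous_const).measurableSet)

theorem measurableSet_chartPiece (f : Fin m → MvPolynomial (Fin (N + 1)) R)
    (k : Fin m ↪o Fin (N + 1)) : MeasurableSet (chartPiece (K := K) f k) := by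
  have hm : ∀ k' : Fin m ↪o Fin (N + 1),
      Measurable fun x : coneSet K f => minor f k' x.1 := fun k' =>
    ((continuous_minor f k').comp continuous_subtype_val).measurable
  unfold chartPiece
  have : {x : coneSet K f | minor f k x.1 ≠ 0 ∧ ∀ k' : Fin m ↪o Fin (N + 1),
    ‖minor f k' x.1‖ < ‖minor f k x.1‖ ∨
      (‖minor f k' x.1‖ = ‖minor f k x.1‖ ∧
        toLex (k : Fin m → Fin (N + 1)) ≤ toLex (k' : Fin m → Fin (N + 1)))}
    = {x : coneSet K f | minor f k x.1 = 0}ᶜ ∩ ⋂ k' : Fin m ↪o Fin (N + 1),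
      ({x : coneSet K f | ‖minor f k' x.1‖ < ‖minor f k x.1‖} ∪
      ({x : coneSet K f | ‖minor f k' x.1‖ = ‖minor f k x.1‖} ∩
        {_x | toLex (k : Fin m → Fin (N + 1)) ≤ toLex (k' : Fin m → Fin (N + 1))})) := by
    ext; simp
  rw [this]
  refine ((hm k) (measurableSet_singleton 0)).compl.inter (MeasurableSet.iInter fun k' => ?_)
  exact (measurableSet_lt (hm k').norm (hm k).norm).union
    ((measurableSet_eq_fun (hm k').norm (hm k).norm).inter (MeasurableSet.const _))

/-- The fibre measures depend measurably on the base point, so that `lerayMeasure` is indeed given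
by the integral formula `lerayMeasure_apply`. -/
theorem measurable_lerayFibre (f : Fin m → MvPolynomial (Fin (N + 1)) R)
    (k : Fin m ↪o Fin (N + 1)) : Measurable (lerayFibre (K := K) f k) := by
  classical
  have : StandardBorelSpace (coneSet K f) := (measurableSet_coneSet f).standardBorel
  let w : coneSet K f → ℝ≥0∞ := fun x => ENNReal.ofReal ‖minor f k x.1‖⁻¹
  have hw : Measurable w := by
    have := ((continuous_minor f k).comp (continuous_subtype_val (p := (· ∈ coneSet K f)))).measurable
    exact this.norm.inv.ennreal_ofReal
  let π : coneSet K f → ({j : Fin (N + 1) // j ∉ Set.range k} → K) := fun x => dropCoords k x.1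
  have hπ : Measurable π := by
    refine measurable_pi_lambda _ fun j => ?_
    exact (measurable_pi_apply j.1).comp measurable_subtype_coe
  choose! U hU hinj using exists_injOn (K := K) f k
  obtain ⟨t, hts, htc, ht⟩ := TopologicalSpace.countable_cover_nhdsWithin
    (f := fun x => interior (U x)) (s := {x : coneSet K f | minor f k x.1 ≠ 0})
    (fun x hx => mem_nhdsWithin_of_mem_nhds (interior_mem_nhds.2 (hU x hx)))
  obtain ⟨e, he, hem, hec⟩ : ∃ e : ℕ → Set (coneSet K f), (∀ n, InjOn π (e n)) ∧
      (∀ n, MeasurableSet (e n)) ∧ {x : coneSet K f | minor f k x.1 ≠ 0} ⊆ ⋃ n, e n := by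
    rcases t.eq_empty_or_nonempty with h | h
    · subst h
      exact ⟨fun _ => ∅, by simp, by simp, by simpa using ht⟩
    · obtain ⟨a, rfl⟩ := htc.exists_eq_range h
      refine ⟨fun n => interior (U (a n)), fun n => ?_, fun n => isOpen_interior.measurableSet, ?_⟩
      · exact (hinj (a n) (hts ⟨n, rfl⟩)).mono interior_subset
      · simpa using ht
  refine Measure.measurable_of_measurable_coe _ fun s hs => ?_
  let C : ℕ → Set (coneSet K f) := fun n => (chartPiece f k ∩ s) ∩ disjointed e n
  have hC : ∀ n, MeasurableSet (C n) := fun n =>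
    ((measurableSet_chartPiece f k).inter hs).inter (.disjointed hem n)
  have hCd : ∀ a b, a ≠ b → Disjoint (C a) (C b) := fun a b hab =>
    ((disjoint_disjointed e) hab).mono inter_subset_right inter_subset_right
  have hCu : ⋃ n, C n = chartPiece f k ∩ s := by
    rw [← inter_iUnion, iUnion_disjointed]
    exact inter_eq_left.2 fun x hx => hec hx.1.1
  have hCi : ∀ n, InjOn π (C n) := fun n =>
    (he n).mono (inter_subset_right.trans (disjointed_subset e n))
  have key : (fun y => lerayFibre f k y s) = fun y => ∑' n,
      Function.extend (fun x : C n => π x.1) (fun x => w x.1) (fun _ => 0) y := by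
    funext y
    have h1 : lerayFibre f k y s = ∑' x, {x | x ∈ chartPiece f k ∧ π x = y}.indicator
        (fun x => w x * s.indicator 1 x) x := by
      rw [← tsum_subtype, lerayFibre, Measure.sum_apply _ hs]
      refine tsum_congr fun x => ?_
      simp [Measure.dirac_apply' _ hs, w]
    have h2 : ∀ n, Function.extend (fun x : C n => π x.1) (fun x => w x.1) (fun _ => 0) y
        = ∑' x, (C n ∩ π ⁻¹' {y}).indicator w x := by
      intro n
      by_cases h : ∃ x : C n, π x.1 = y
      · obtain ⟨x, rfl⟩ := h
        have hi : Function.Injective (fun x : C n => π x.1) := (hCi n).injective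
        rw [hi.extend_apply (fun x : C n => w x.1), tsum_eq_single x.1]
        · rw [indicator_of_mem]; exact ⟨x.2, rfl⟩
        · intro z hz
          rw [indicator_of_notMem]
          exact fun hz' => hz ((hCi n) hz'.1 x.2 hz'.2)
      · rw [Function.extend_apply' _ _ _ h]
        symm
        rw [ENNReal.tsum_eq_zero]
        intro x
        rw [indicator_of_notMem]
        exact fun hx => h ⟨⟨x, hx.1⟩, hx.2⟩
    rw [h1, tsum_congr h2, ENNReal.tsum_comm]
    refine tsum_congr fun x => ?_
    by_cases hx : x ∈ chartPiece f k ∩ s ∧ π x = y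
    · obtain ⟨n, hn⟩ := mem_iUnion.1 (hCu.symm ▸ hx.1 : x ∈ ⋃ n, C n)
      rw [tsum_eq_single n, indicator_of_mem (show x ∈ {x | x ∈ chartPiece f k ∧ π x = y} from ⟨hx.1.1, hx.2⟩),
         indicator_of_mem (show x ∈ C n ∩ π ⁻¹' {y} from ⟨hn, hx.2⟩),
        indicator_of_mem hx.1.2]
      · simp
      · intro n' hn'
        rw [indicator_of_notMem]
        intro h
        exact disjoint_left.1 (hCd _ _ hn') h.1 hn
    · trans 0
      · by_cases h : x ∈ s
        · rw [indicator_of_notMem]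
          exact fun h' => hx ⟨⟨h'.1, h⟩, h'.2⟩
        · rw [indicator_apply]; simp [h]
      · symm
        rw [ENNReal.tsum_eq_zero]
        intro n
        rw [indicator_of_notMem]
        exact fun h => hx ⟨h.1.1, h.2⟩
  rw [key]
  refine Measurable.tsum fun n => ?_
  have : StandardBorelSpace (C n) := (hC n).standardBorel
  exact (Measurable.measurableEmbedding (hπ.comp measurable_subtype_coe)
    (hCi n).injective).measurable_extend (hw.comp measurable_subtype_coe) measurable_const

theorem lerayMeasure_apply (f : Fin m → MvPolynomial (Fin (N + 1)) R) (μ : Measure K)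
    {A : Set (coneSet K f)} (hA : MeasurableSet A) :
    lerayMeasure f μ A = ∑ k : Fin m ↪o Fin (N + 1),
      ∫⁻ y, ∑' x : {x : coneSet K f // x ∈ chartPiece f k ∧ dropCoords k x.1 = y},
        ENNReal.ofReal ‖minor f k x.1.1‖⁻¹ * A.indicator 1 x.1
          ∂(Measure.pi fun _ : {j : Fin (N + 1) // j ∉ Set.range k} => μ) := by
  rw [lerayMeasure, Measure.sum_apply _ hA, tsum_fintype]
  refine Finset.sum_congr rfl fun k _ => ?_
  rw [Measure.bind_apply hA (measurable_lerayFibre f k).aemeasurable]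
  refine lintegral_congr fun y => ?_
  rw [lerayFibre, Measure.sum_apply _ hA]
  refine tsum_congr fun x => ?_
  simp [Measure.dirac_apply' _ hA]

end Measurability

section Count

variable {m N : ℕ}

/-- The number of solutions of `f = 0` in `(𝒪 / 𝔪^r)^{N+1}`, where `𝔪` is the maximal ideal of the
local ring `𝒪`. -/
noncomputable def solutionCount {R : Type*} [CommRing R] (O : Type*) [CommRing O] [IsLocalRing O]
    [Algebra R O] (f : Fin m → MvPolynomial (Fin (N + 1)) R) (r : ℕ) : ℕ :=
  Nat.card {x : Fin (N + 1) → O ⧸ IsLocalRing.maximalIdeal O ^ r //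
    ∀ i, MvPolynomial.aeval x (f i) = 0}

end Count

end LerayDensity

/-! Let `q` be the size of the residue field, `a` a uniformizer, so that `‖a‖ = 1/q`, and `t =
q^{-(N+1-md)}`. Cutting the integral points into cosets modulo the `r`-th power of the maximal ideal
turns the count into a volume (`measure_nearZeros_eq`): the normalized count is `u r = q^{rm} · vol
{‖x‖ ≤ 1, ‖f x‖ ≤ q^{-r}}`. The affine cone may be singular at the origin but nowhere else, so
primitive points (`‖x‖ = 1`) are treated directly and the others are reached by scaling.

Primitive points. The `f i` and the maximal minors have no common geometric zero except the origin,
so by the Nullstellensatz they generate a power of each variable. Hence a single `e > 0` bounds some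
minor from below at every primitive `x` with `‖f x‖ < e`
(`IsSmoothCompleteIntersection.exists_minorBound`). Fix a chart `k` and the remaining coordinates
`y`. If `ε < e` and `ε < e²`, Hensel's lemma and Taylor expansion show that the approximate zeros
over `y` are the disjoint union, over the true zeros `x`, of the sets `‖J(x)(z - x ∘ k)‖ ≤ ε`, each
of volume `|det J(x)|⁻¹ · vol(ball ε)^m`. Integrating over `y` produces the Leray density
(`measure_norm_eq_one_near`): for all large `r` the volume of the primitive approximate zeros is
exactly `q^{-rm} p`, where `p` is the Leray mass of the primitive zeros. In particular `p` is
finite.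

Scaling. Dividing a non-primitive point by `a` replaces the level `r + d` by `r`, whence `u (r + d)
= p + t · u r` for large `r`. Since `N + 1 - md ≥ 1`, `t < 1` and `u r` tends to `p / (1 - t)`. The
Leray measure is homogeneous too (`lerayMeasure_norm_eq`): the shell `‖x‖ = q^{-n}` has mass `t^n
p`, and the geometric series gives the same value `p / (1 - t)`. -/

namespace LerayDensity

/-! ### Ultrametric estimates for integral polynomials and matrices -/

section Ultrametric

open MvPolynomial

variable {R : Type*} [CommRing R] {ι : Type*} [Fintype ι] {K : Type*} [NontriviallyNormedField K]
  [IsUltrametricDist K] [Algebra R K]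

theorem norm_add_le_of_le_of_le {E : Type*} [SeminormedAddGroup E] [IsUltrametricDist E] {a b : E}
    {c : ℝ} (ha : ‖a‖ ≤ c) (hb : ‖b‖ ≤ c) : ‖a + b‖ ≤ c :=
  (IsUltrametricDist.norm_add_le_max a b).trans (max_le ha hb)

theorem norm_sub_le_of_le_of_le {E : Type*} [SeminormedAddGroup E] [IsUltrametricDist E] {a b : E}
    {c : ℝ} (ha : ‖a‖ ≤ c) (hb : ‖b‖ ≤ c) : ‖a - b‖ ≤ c :=
  sub_eq_add_neg a b ▸ norm_add_le_of_le_of_le ha ((norm_neg b).trans_le hb)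

theorem norm_aeval_le_one (hR : ∀ a : R, ‖algebraMap R K a‖ ≤ 1) (p : MvPolynomial ι R)
    {x : ι → K} (hx : ‖x‖ ≤ 1) : ‖aeval x p‖ ≤ 1 := by
  induction p using MvPolynomial.induction_on with
  | C a => simpa using hR a
  | add p q hp hq => rw [map_add]; exact norm_add_le_of_le_of_le hp hq
  | mul_X p i hp =>
    rw [map_mul, aeval_X, norm_mul]
    exact mul_le_one₀ hp (norm_nonneg _) ((norm_le_pi_norm x i).trans hx)

theorem norm_aeval_sub_aeval_le (hR : ∀ a : R, ‖algebraMap R K a‖ ≤ 1) (p : MvPolynomial ι R)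
    {x y : ι → K} (hx : ‖x‖ ≤ 1) (hy : ‖y‖ ≤ 1) :
    ‖aeval y p - aeval x p‖ ≤ ‖y - x‖ := by
  induction p using MvPolynomial.induction_on with
  | C a => simp
  | add p q hp hq =>
    rw [map_add, map_add, add_sub_add_comm]
    exact norm_add_le_of_le_of_le hp hq
  | mul_X p i hp =>
    have : aeval y (p * X i) - aeval x (p * X i) =
        (aeval y p - aeval x p) * x i + aeval y p * (y - x) i := by
      simp; ring
    rw [this]
    refine norm_add_le_of_le_of_le ?_ ?_
    · rw [norm_mul]
      exact (mul_le_mul hp ((norm_le_pi_norm x i).trans hx) (norm_nonneg _) (norm_nonneg _)).trans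
        (mul_one _).le
    · rw [norm_mul]
      exact (mul_le_mul (norm_aeval_le_one hR p hy) (norm_le_pi_norm (y - x) i) (norm_nonneg _)
        zero_le_one).trans (one_mul _).le

/-- Taylor expansion to first order of a polynomial with integral coefficients, on the unit
ball. -/
theorem norm_aeval_sub_aeval_sub_sum_le (hR : ∀ a : R, ‖algebraMap R K a‖ ≤ 1)
    (p : MvPolynomial ι R) {x y : ι → K} (hx : ‖x‖ ≤ 1) (hy : ‖y‖ ≤ 1) :
    ‖aeval y p - aeval x p - ∑ j, aeval x (pderiv j p) * (y - x) j‖ ≤ ‖y - x‖ ^ 2 := by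
  classical
  induction p using MvPolynomial.induction_on with
  | C a => simp
  | add p q hp hq =>
    have : aeval y (p + q) - aeval x (p + q) - ∑ j, aeval x (pderiv j (p + q)) * (y - x) j =
        (aeval y p - aeval x p - ∑ j, aeval x (pderiv j p) * (y - x) j) +
        (aeval y q - aeval x q - ∑ j, aeval x (pderiv j q) * (y - x) j) := by
      simp only [map_add, add_mul, Finset.sum_add_distrib]; ring
    rw [this]
    exact norm_add_le_of_le_of_le hp hq
  | mul_X p i hp =>
    have h1 : ∑ j, aeval x (pderiv j (p * X i)) * (y - x) j =
        x i * ∑ j, aeval x (pderiv j p) * (y - x) j + aeval x p * (y - x) i := by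
      have h2 : ∀ j, aeval x (pderiv j (p * X i)) * (y - x) j =
          x i * (aeval x (pderiv j p) * (y - x) j) +
            (if i = j then aeval x p * (y - x) j else 0) := by
        intro j
        rw [pderiv_mul, pderiv_X]
        by_cases h1 : i = j
        · subst h1; simp; ring
        · rw [Pi.single_eq_of_ne h1]; simp [h1]; ring
      simp only [h2, Finset.sum_add_distrib, Finset.mul_sum]
      simp
    -- The product rule leaves two errors: the remainder of `p` times `x i`, and a product of two
    -- first-order increments. Both are of second order.
    have : aeval y (p * X i) - aeval x (p * X i) - ∑ j, aeval x (pderiv j (p * X i)) * (y - x) j =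
        (aeval y p - aeval x p - ∑ j, aeval x (pderiv j p) * (y - x) j) * x i +
          (aeval y p - aeval x p) * (y - x) i := by
      rw [h1]; simp; ring
    rw [this]
    refine norm_add_le_of_le_of_le ?_ ?_
    · rw [norm_mul]
      exact (mul_le_mul hp ((norm_le_pi_norm x i).trans hx) (norm_nonneg _) (by positivity)).trans
        (mul_one _).le
    · rw [norm_mul, sq]
      exact mul_le_mul (norm_aeval_sub_aeval_le hR p hx hy) (norm_le_pi_norm (y - x) i)
        (norm_nonneg _) (norm_nonneg _)

theorem norm_det_le_one [DecidableEq ι] {A : Matrix ι ι K} (hA : ∀ i j, ‖A i j‖ ≤ 1) :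
    ‖A.det‖ ≤ 1 := by
  rw [Matrix.det_apply']
  refine IsUltrametricDist.norm_sum_le_of_forall_le_of_nonneg zero_le_one fun s _ => ?_
  rw [norm_mul, norm_prod]
  refine mul_le_one₀ ?_ (Finset.prod_nonneg fun _ _ => norm_nonneg _)
    (Finset.prod_le_one (fun _ _ => norm_nonneg _) fun _ _ => hA _ _)
  rcases Int.units_eq_one_or (Equiv.Perm.sign s) with h | h <;> simp [h]

theorem norm_mulVec_le {A : Matrix ι ι K} (hA : ∀ i j, ‖A i j‖ ≤ 1) (v : ι → K) :
    ‖A.mulVec v‖ ≤ ‖v‖ := by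
  refine (pi_norm_le_iff_of_nonneg (norm_nonneg _)).2 fun i => ?_
  refine IsUltrametricDist.norm_sum_le_of_forall_le_of_nonneg (norm_nonneg _) fun j _ => ?_
  rw [norm_mul]
  exact (mul_le_mul (hA i j) (norm_le_pi_norm v j) (norm_nonneg _) zero_le_one).trans
    (one_mul _).le

/-- The adjugate of an integral matrix is integral, so it does not increase norms, and it carries `A
v` to `det A • v`. This is the quantitative invertibility behind the Hensel argument. -/
theorem norm_det_mul_norm_le [DecidableEq ι] {A : Matrix ι ι K} (hA : ∀ i j, ‖A i j‖ ≤ 1)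
    (v : ι → K) : ‖A.det‖ * ‖v‖ ≤ ‖A.mulVec v‖ := by
  have h1 : A.det • v = A.adjugate.mulVec (A.mulVec v) := by
    rw [Matrix.mulVec_mulVec, Matrix.adjugate_mul, Matrix.smul_mulVec, Matrix.one_mulVec]
  rw [← norm_smul, h1]
  refine norm_mulVec_le (fun i j => ?_) _
  rw [Matrix.adjugate_apply]
  refine norm_det_le_one fun a b => ?_
  rw [Matrix.updateRow_apply]
  split_ifs
  · by_cases h : b = i
    · subst h; simp
    · simp [Pi.single_eq_of_ne h]
  · exact hA a b

end Ultrametric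

/-! ### The chart attached to a largest minor, and Hensel's lemma -/

section Chart

open MvPolynomial

variable {R : Type*} [CommRing R] {m N : ℕ} {K : Type*} [NontriviallyNormedField K]
  [Algebra R K]

/-- The Jacobian matrix of `f` with respect to the coordinates `k`. -/
noncomputable def jacobian (f : Fin m → MvPolynomial (Fin (N + 1)) R) (k : Fin m ↪o Fin (N + 1))
    (x : Fin (N + 1) → K) : Matrix (Fin m) (Fin m) K :=
  Matrix.of fun i j => aeval x (pderiv (k j) (f i))

theorem det_jacobian (f : Fin m → MvPolynomial (Fin (N + 1)) R) (k : Fin m ↪o Fin (N + 1))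
    (x : Fin (N + 1) → K) : (jacobian f k x).det = minor f k x := rfl

/-- The minors as polynomials. -/
noncomputable def minorPoly (f : Fin m → MvPolynomial (Fin (N + 1)) R)
    (k : Fin m ↪o Fin (N + 1)) : MvPolynomial (Fin (N + 1)) R :=
  Matrix.det (Matrix.of fun i j => pderiv (k j) (f i))

theorem aeval_minorPoly {L : Type*} [Field L] [Algebra R L]
    (f : Fin m → MvPolynomial (Fin (N + 1)) R) (k : Fin m ↪o Fin (N + 1))
    (x : Fin (N + 1) → L) : aeval x (minorPoly f k) = minor f k x := by
  rw [minorPoly, AlgHom.map_det]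
  rfl

/-- The chart given by `k` is the one used at `x`. -/
def ChartAt (f : Fin m → MvPolynomial (Fin (N + 1)) R) (k : Fin m ↪o Fin (N + 1))
    (x : Fin (N + 1) → K) : Prop :=
  minor f k x ≠ 0 ∧ ∀ k' : Fin m ↪o Fin (N + 1),
    ‖minor f k' x‖ < ‖minor f k x‖ ∨
      (‖minor f k' x‖ = ‖minor f k x‖ ∧
        toLex (k : Fin m → Fin (N + 1)) ≤ toLex (k' : Fin m → Fin (N + 1)))

theorem ChartAt.norm_minor_le {f : Fin m → MvPolynomial (Fin (N + 1)) R}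
    {k : Fin m ↪o Fin (N + 1)} {x : Fin (N + 1) → K} (h : ChartAt f k x)
    (k' : Fin m ↪o Fin (N + 1)) : ‖minor f k' x‖ ≤ ‖minor f k x‖ :=
  (h.2 k').elim le_of_lt fun h => h.1.le

theorem ChartAt.unique {f : Fin m → MvPolynomial (Fin (N + 1)) R}
    {k k' : Fin m ↪o Fin (N + 1)} {x : Fin (N + 1) → K} (h : ChartAt f k x)
    (h' : ChartAt f k' x) : k = k' := by
  have e : ‖minor f k' x‖ = ‖minor f k x‖ := le_antisymm (h.norm_minor_le k') (h'.norm_minor_le k)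
  have h1 := ((h.2 k').resolve_left e.not_lt).2
  have h2 := ((h'.2 k).resolve_left e.symm.not_lt).2
  exact DFunLike.coe_injective (toLex_inj.1 (le_antisymm h1 h2))

/-- Take the lexicographically least among the minors of maximal norm. Together with
`ChartAt.unique` this shows that the charts partition the points where some minor is nonzero. -/
theorem exists_chartAt {f : Fin m → MvPolynomial (Fin (N + 1)) R}
    {x : Fin (N + 1) → K} (h : ∃ k, minor f k x ≠ 0) : ∃ k, ChartAt f k x := by
  obtain ⟨k₀, hk₀⟩ := h
  obtain ⟨k₁, -, hk₁⟩ := Finset.exists_max_image (Finset.univ : Finset (Fin m ↪o Fin (N + 1)))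
    (fun k => ‖minor f k x‖) ⟨k₀, Finset.mem_univ _⟩
  obtain ⟨k₂, hk₂, hk₂'⟩ := Finset.exists_min_image
    {k : Fin m ↪o Fin (N + 1) | ‖minor f k x‖ = ‖minor f k₁ x‖}
    (fun k => toLex (k : Fin m → Fin (N + 1))) ⟨k₁, by simp⟩
  have hk₂ : ‖minor f k₂ x‖ = ‖minor f k₁ x‖ := by simpa using hk₂
  refine ⟨k₂, ?_, fun k' => ?_⟩
  · rw [← norm_pos_iff, hk₂]
    exact (norm_pos_iff.2 hk₀).trans_le (hk₁ k₀ (Finset.mem_univ _))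
  · rw [hk₂]
    rcases (hk₁ k' (Finset.mem_univ _)).lt_or_eq with h | h
    · exact Or.inl h
    · exact Or.inr ⟨h, hk₂' k' (by simpa using h)⟩

theorem norm_sub_eq_norm_comp {k : Fin m ↪o Fin (N + 1)} {x y : Fin (N + 1) → K}
    (h : dropCoords k y = dropCoords k x) : ‖y - x‖ = ‖(y - x) ∘ k‖ := by
  refine le_antisymm ((pi_norm_le_iff_of_nonneg (norm_nonneg _)).2 fun j => ?_)
    ((pi_norm_le_iff_of_nonneg (norm_nonneg _)).2 fun j => norm_le_pi_norm (y - x) (k j))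
  by_cases hj : j ∈ Set.range k
  · obtain ⟨i, rfl⟩ := hj
    exact norm_le_pi_norm ((y - x) ∘ k) i
  · have : y j = x j := congrFun h ⟨j, hj⟩
    simp [this]

variable [IsUltrametricDist K]

theorem norm_minor_sub_minor_le (hR : ∀ a : R, ‖algebraMap R K a‖ ≤ 1)
    (f : Fin m → MvPolynomial (Fin (N + 1)) R) (k : Fin m ↪o Fin (N + 1))
    {x y : Fin (N + 1) → K} (hx : ‖x‖ ≤ 1) (hy : ‖y‖ ≤ 1) :
    ‖minor f k y - minor f k x‖ ≤ ‖y - x‖ := by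
  rw [← aeval_minorPoly, ← aeval_minorPoly]
  exact norm_aeval_sub_aeval_le hR _ hx hy

theorem norm_minor_le_one (hR : ∀ a : R, ‖algebraMap R K a‖ ≤ 1)
    (f : Fin m → MvPolynomial (Fin (N + 1)) R) (k : Fin m ↪o Fin (N + 1))
    {x : Fin (N + 1) → K} (hx : ‖x‖ ≤ 1) : ‖minor f k x‖ ≤ 1 := by
  rw [← aeval_minorPoly]
  exact norm_aeval_le_one hR _ hx

theorem norm_eq_of_norm_sub_lt {E : Type*} [SeminormedAddGroup E] [IsUltrametricDist E]
    {a b : E} (h : ‖b - a‖ < ‖a‖) : ‖b‖ = ‖a‖ := by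
  have := IsUltrametricDist.norm_add_eq_max_of_norm_ne_norm h.ne
  rwa [sub_add_cancel, max_eq_right h.le] at this

theorem norm_minor_eq (hR : ∀ a : R, ‖algebraMap R K a‖ ≤ 1)
    {f : Fin m → MvPolynomial (Fin (N + 1)) R} {k : Fin m ↪o Fin (N + 1)}
    {x y : Fin (N + 1) → K} (hx : ‖x‖ ≤ 1) (hy : ‖y‖ ≤ 1) (h : ‖y - x‖ < ‖minor f k x‖) :
    ‖minor f k y‖ = ‖minor f k x‖ :=
  norm_eq_of_norm_sub_lt ((norm_minor_sub_minor_le hR f k hx hy).trans_lt h)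

/-- Minors are 1-Lipschitz on the unit ball. Moving by less than the largest minor therefore
preserves the norm of every minor of maximal size and keeps the others strictly smaller, so neither
the maximum nor the tie-break changes. An approximate zero and the nearby true zero thus lie in the
same chart. -/
theorem ChartAt.of_norm_sub_lt (hR : ∀ a : R, ‖algebraMap R K a‖ ≤ 1)
    {f : Fin m → MvPolynomial (Fin (N + 1)) R} {k : Fin m ↪o Fin (N + 1)}
    {x y : Fin (N + 1) → K} (hc : ChartAt f k x) (hx : ‖x‖ ≤ 1) (hy : ‖y‖ ≤ 1)
    (h : ‖y - x‖ < ‖minor f k x‖) : ChartAt f k y := by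
  have hk := norm_minor_eq hR hx hy h
  refine ⟨?_, fun k' => ?_⟩
  · rw [← norm_pos_iff, hk]; exact norm_pos_iff.2 hc.1
  · rw [hk]
    rcases hc.2 k' with h1 | h1
    · left
      have := IsUltrametricDist.norm_add_le_max (minor f k' y - minor f k' x) (minor f k' x)
      rw [sub_add_cancel] at this
      exact this.trans_lt (max_lt ((norm_minor_sub_minor_le hR f k' hx hy).trans_lt h) h1)
    · right
      refine ⟨?_, h1.2⟩
      rw [← h1.1]
      exact norm_minor_eq hR hx hy (h1.1 ▸ h)

theorem norm_jacobian_apply_le (hR : ∀ a : R, ‖algebraMap R K a‖ ≤ 1)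
    (f : Fin m → MvPolynomial (Fin (N + 1)) R) (k : Fin m ↪o Fin (N + 1))
    {x : Fin (N + 1) → K} (hx : ‖x‖ ≤ 1) (i j : Fin m) : ‖jacobian f k x i j‖ ≤ 1 :=
  norm_aeval_le_one hR _ hx

theorem norm_minor_mul_norm_le (hR : ∀ a : R, ‖algebraMap R K a‖ ≤ 1)
    (f : Fin m → MvPolynomial (Fin (N + 1)) R) (k : Fin m ↪o Fin (N + 1))
    {x : Fin (N + 1) → K} (hx : ‖x‖ ≤ 1) (v : Fin m → K) :
    ‖minor f k x‖ * ‖v‖ ≤ ‖(jacobian f k x).mulVec v‖ :=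
  norm_det_mul_norm_le (norm_jacobian_apply_le hR f k hx) v

/-- Taylor expansion in the coordinates `k`. -/
theorem norm_sub_sub_jacobian_mulVec_le (hR : ∀ a : R, ‖algebraMap R K a‖ ≤ 1)
    (f : Fin m → MvPolynomial (Fin (N + 1)) R) {k : Fin m ↪o Fin (N + 1)}
    {x y : Fin (N + 1) → K} (hx : ‖x‖ ≤ 1) (hy : ‖y‖ ≤ 1) (h : dropCoords k y = dropCoords k x) :
    ‖(fun i => aeval y (f i)) - (fun i => aeval x (f i)) - (jacobian f k x).mulVec ((y - x) ∘ k)‖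
      ≤ ‖y - x‖ ^ 2 := by
  refine (pi_norm_le_iff_of_nonneg (by positivity)).2 fun i => ?_
  have h1 : ∑ j, aeval x (pderiv j (f i)) * (y - x) j =
      ∑ a, aeval x (pderiv (k a) (f i)) * (y - x) (k a) := by
    rw [← Finset.sum_image (f := fun j => aeval x (pderiv j (f i)) * (y - x) j)
      (g := fun j => k j) (s := Finset.univ) k.injective.injOn]
    refine (Finset.sum_subset (Finset.subset_univ _) fun j _ hj => ?_).symm
    have : y j = x j := congrFun h ⟨j, by simpa using hj⟩
    rw [Pi.sub_apply, this, sub_self, mul_zero]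
  have h2 := norm_aeval_sub_aeval_sub_sum_le hR (f i) hx hy
  rw [h1] at h2
  exact h2

/-- Hensel's lemma in several variables. -/
theorem exists_root_of_norm_lt [ProperSpace K] (hR : ∀ a : R, ‖algebraMap R K a‖ ≤ 1)
    (f : Fin m → MvPolynomial (Fin (N + 1)) R) (k : Fin m ↪o Fin (N + 1))
    {x : Fin (N + 1) → K} (hx : ‖x‖ ≤ 1) {ε : ℝ} (hf : ‖fun i => aeval x (f i)‖ ≤ ε)
    (hε : ε < ‖minor f k x‖ ^ 2) :
    ∃ y, dropCoords k y = dropCoords k x ∧ ‖y - x‖ ≤ ε / ‖minor f k x‖ ∧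
      ∀ i, aeval y (f i) = 0 := by
  set δ := ‖minor f k x‖ with hδ
  have hε0 : 0 ≤ ε := (norm_nonneg _).trans hf
  have hδ0 : 0 < δ := by
    rcases (norm_nonneg (minor f k x)).lt_or_eq with h | h
    · exact h
    · rw [hδ, ← h] at hε; norm_num at hε; linarith
  have hδ1 : δ ≤ 1 := norm_minor_le_one hR f k hx
  have hεδ : ε / δ < δ := by rw [div_lt_iff₀ hδ0, ← sq]; exact hε
  have hne : ∀ y, ‖y - x‖ ≤ ε / δ → ‖y‖ ≤ 1 := fun y hy => by
    have := norm_add_le_of_le_of_le (hy.trans (hεδ.le.trans hδ1)) hx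
    rwa [sub_add_cancel] at this
  have hcont : Continuous fun y : Fin (N + 1) → K => ‖fun i => aeval y (f i)‖ :=
    (continuous_pi fun i => continuous_aeval_point (f i)).norm
  have hdrop : Continuous (dropCoords k : (Fin (N + 1) → K) → _) :=
    continuous_pi fun j => continuous_apply j.1
  -- Instead of iterating Newton's method, minimize `‖f‖` on a compact slice of the ball; a nonzero
  -- minimum will be improved by a single Newton step.
  have hC : IsCompact (Metric.closedBall x (ε / δ) ∩ {y | dropCoords k y = dropCoords k x}) :=
    (isCompact_closedBall _ _).inter_right (isClosed_eq hdrop continuous_const)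
  obtain ⟨y, ⟨hy1, hy2⟩, hmin⟩ := hC.exists_isMinOn
    ⟨x, Metric.mem_closedBall_self (by positivity), rfl⟩ hcont.continuousOn
  rw [mem_closedBall_iff_norm] at hy1
  have hyn := hne y hy1
  refine ⟨y, hy2, hy1, ?_⟩
  set g : Fin m → K := fun i => aeval y (f i) with hg
  have hgε : ‖g‖ ≤ ε :=
    (hmin (show x ∈ _ from ⟨Metric.mem_closedBall_self (by positivity), rfl⟩)).trans hf
  by_contra hne0
  have hg0 : 0 < ‖g‖ := norm_pos_iff.2 fun h => hne0 fun i => congrFun h i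
  have hyδ : ‖minor f k y‖ = δ := norm_minor_eq hR hx hyn (hy1.trans_lt hεδ)
  have hunit : IsUnit (jacobian f k y).det := by
    rw [det_jacobian, isUnit_iff_ne_zero, ← norm_pos_iff, hyδ]; exact hδ0
  -- The Newton correction at the minimizer `y`, applied in the coordinates `k` only. It has size at
  -- most `‖g‖ / δ`, so the new point `z` stays in the ball.
  set v : Fin m → K := -((jacobian f k y)⁻¹.mulVec g) with hv
  have hJv : (jacobian f k y).mulVec v = -g := by
    rw [hv, Matrix.mulVec_neg, Matrix.mulVec_mulVec, Matrix.mul_nonsing_inv _ hunit,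
      Matrix.one_mulVec]
  have hvn : ‖v‖ ≤ ‖g‖ / δ := by
    have := norm_minor_mul_norm_le hR f k hyn v
    rw [hJv, norm_neg g, hyδ] at this
    rwa [le_div_iff₀ hδ0, mul_comm]
  let z : Fin (N + 1) → K := y + Function.extend k v 0
  have hzk : (z - y) ∘ k = v := by
    funext i
    simp [z, k.injective.extend_apply]
  have hzd : dropCoords k z = dropCoords k y := by
    funext j
    have : Function.extend k v 0 j.1 = 0 := by
      rw [Function.extend_apply' _ _ _ fun ⟨a, ha⟩ => j.2 ⟨a, ha⟩]; rfl
    simp [dropCoords, z, this]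
  have hzy : ‖z - y‖ ≤ ‖g‖ / δ := by rw [norm_sub_eq_norm_comp hzd, hzk]; exact hvn
  have hzx : ‖z - x‖ ≤ ε / δ := by
    have := norm_add_le_of_le_of_le (hzy.trans (by gcongr : ‖g‖ / δ ≤ ε / δ)) hy1
    rwa [sub_add_sub_cancel] at this
  have h1 := norm_sub_sub_jacobian_mulVec_le hR f hyn (hne z hzx) hzd
  rw [hzk, hJv, ← hg, sub_neg_eq_add, sub_add_cancel] at h1
  have h2 : ‖g‖ ≤ ‖fun i => aeval z (f i)‖ :=
    hmin (show z ∈ _ from ⟨mem_closedBall_iff_norm.2 hzx, hzd.trans hy2⟩)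
  -- The linear term cancels `g`, so only the quadratic error remains: `‖f z‖ ≤ (‖g‖ / δ)²`. This is
  -- less than `‖g‖` because `‖g‖ ≤ ε < δ²`, against minimality.
  have h3 : ‖z - y‖ ^ 2 ≤ (‖g‖ / δ) ^ 2 := by gcongr
  have h4 : (‖g‖ / δ) ^ 2 < ‖g‖ := by
    rw [div_pow, div_lt_iff₀ (by positivity), sq]
    exact mul_lt_mul_of_pos_left (hgε.trans_lt hε) hg0
  linarith

/-- When the quadratic error is at most `ε`, the ultrametric inequality lets `f` be replaced by its
linear part without loss. Approximate zeros near a root then form exactly a linear preimage of a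
ball, so the volume comparison is an equality. -/
theorem norm_aeval_le_iff_of_root (hR : ∀ a : R, ‖algebraMap R K a‖ ≤ 1)
    (f : Fin m → MvPolynomial (Fin (N + 1)) R) {k : Fin m ↪o Fin (N + 1)}
    {x y : Fin (N + 1) → K} (hx : ‖x‖ ≤ 1) (hy : ‖y‖ ≤ 1) (h : dropCoords k y = dropCoords k x)
    (hx0 : ∀ i, aeval x (f i) = 0) {ε : ℝ} (hyx : ‖y - x‖ ^ 2 ≤ ε) :
    ‖fun i => aeval y (f i)‖ ≤ ε ↔ ‖(jacobian f k x).mulVec ((y - x) ∘ k)‖ ≤ ε := by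
  have h1 := (norm_sub_sub_jacobian_mulVec_le hR f hx hy h).trans hyx
  have h2 : (fun i => aeval x (f i)) = 0 := funext hx0
  rw [h2, sub_zero] at h1
  refine ⟨fun h => ?_, fun h => ?_⟩
  · have := norm_sub_le_of_le_of_le h h1
    rwa [sub_sub_cancel] at this
  · have := norm_add_le_of_le_of_le h1 h
    rwa [sub_add_cancel] at this

/-- For two distinct roots the linear term, at least `‖minor‖ · ‖y - x‖`, would have to be at most
the quadratic error `‖y - x‖²`. -/
theorem root_unique (hR : ∀ a : R, ‖algebraMap R K a‖ ≤ 1)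
    (f : Fin m → MvPolynomial (Fin (N + 1)) R) {k : Fin m ↪o Fin (N + 1)}
    {x y : Fin (N + 1) → K} (hx : ‖x‖ ≤ 1) (hy : ‖y‖ ≤ 1) (h : dropCoords k y = dropCoords k x)
    (hx0 : ∀ i, aeval x (f i) = 0) (hy0 : ∀ i, aeval y (f i) = 0)
    (hyx : ‖y - x‖ < ‖minor f k x‖) : y = x := by
  by_contra hne
  have h0 : 0 < ‖y - x‖ := norm_pos_iff.2 (sub_ne_zero.2 hne)
  have h1 := norm_sub_sub_jacobian_mulVec_le hR f hx hy h
  rw [show (fun i => aeval x (f i)) = 0 from funext hx0,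
    show (fun i => aeval y (f i)) = 0 from funext hy0, sub_zero, zero_sub, norm_neg] at h1
  have h2 := (norm_minor_mul_norm_le hR f k hx ((y - x) ∘ k)).trans h1
  rw [← norm_sub_eq_norm_comp h, sq] at h2
  exact absurd (le_of_mul_le_mul_right h2 h0) (not_le.2 hyx)

end Chart

/-! ### Linear change of variables for product Haar measure -/

section Scaling

open Matrix

variable {K : Type*} [NontriviallyNormedField K] [MeasurableSpace K] [BorelSpace K]

theorem pi_closedBall {K ι : Type*} [NormedField K] [MeasurableSpace K] [Fintype ι]
    (ν : Measure K) [SigmaFinite ν] {ε : ℝ} (hε : 0 ≤ ε) :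
    Measure.pi (fun _ : ι => ν) (Metric.closedBall 0 ε) =
      ν (Metric.closedBall 0 ε) ^ Fintype.card ι := by
  rw [closedBall_pi _ hε, Measure.pi_pi]
  simp

/-- Multiplication by `a` multiplies the measure `μ` by `‖a‖`. -/
def ScalesByNorm (μ : Measure K) : Prop :=
  ∀ a : K, a ≠ 0 → ∀ s : Set K, μ ((a * ·) ⁻¹' s) = ENNReal.ofReal ‖a‖⁻¹ * μ s

variable [SecondCountableTopology K] {ι : Type*} [Fintype ι] [DecidableEq ι] {μ : Measure K}
  [SigmaFinite μ]

theorem measurable_toLin' (M : Matrix ι ι K) : Measurable (toLin' M) :=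
  (LinearMap.continuous_on_pi (toLin' M)).measurable

theorem ScalesByNorm.map_diagonal (hμ : ScalesByNorm μ) {D : ι → K}
    (h : det (diagonal D) ≠ 0) :
    (Measure.pi fun _ : ι => μ).map (toLin' (diagonal D)) =
      ENNReal.ofReal ‖det (diagonal D)‖⁻¹ • Measure.pi fun _ : ι => μ := by
  have hD : ∀ i, D i ≠ 0 := fun i => by
    rw [det_diagonal] at h
    exact Finset.prod_ne_zero_iff.1 h i (Finset.mem_univ i)
  have key : Measure.pi (fun _ : ι => μ) = ENNReal.ofReal ‖det (diagonal D)‖ •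
      (Measure.pi fun _ : ι => μ).map (toLin' (diagonal D)) := by
    refine Measure.pi_eq fun s hs => ?_
    rw [Measure.smul_apply, smul_eq_mul,
      Measure.map_apply (measurable_toLin' _) (MeasurableSet.univ_pi hs)]
    have : (toLin' (diagonal D) ⁻¹' Set.pi Set.univ fun i : ι => s i) =
        Set.pi Set.univ fun i : ι => (D i * ·) ⁻¹' s i := by
      ext f
      simp [mulVec_diagonal]
    rw [this, Measure.pi_pi, det_diagonal, norm_prod,
      ENNReal.ofReal_prod_of_nonneg fun i _ => norm_nonneg (D i), ← Finset.prod_mul_distrib]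
    refine Finset.prod_congr rfl fun i _ => ?_
    rw [hμ _ (hD i), ← mul_assoc, ← ENNReal.ofReal_mul (norm_nonneg _),
      mul_inv_cancel₀ (norm_ne_zero_iff.2 (hD i)), ENNReal.ofReal_one, one_mul]
  conv_rhs => rw [key]
  rw [smul_smul, ← ENNReal.ofReal_mul (by positivity), inv_mul_cancel₀ (norm_ne_zero_iff.2 h),
    ENNReal.ofReal_one, one_smul]

theorem measurePreserving_transvectionStruct [μ.IsAddRightInvariant]
    (t : TransvectionStruct ι K) :
    MeasurePreserving (toLin' t.toMatrix) (Measure.pi fun _ : ι => μ)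
      (Measure.pi fun _ : ι => μ) := by
  have ht : Measurable (toLin' t.toMatrix) := measurable_toLin' _
  refine ⟨ht, ?_⟩
  refine (Measure.pi_eq fun s hs ↦ ?_).symm
  have h2s : MeasurableSet (Set.univ.pi s) := .pi Set.countable_univ fun i _ ↦ hs i
  simp_rw [← Measure.pi_pi, ← lintegral_indicator_one h2s]
  rw [lintegral_map (measurable_one.indicator h2s) ht]
  refine lintegral_eq_of_lmarginal_eq {t.i} ((measurable_one.indicator h2s).comp ht)
    (measurable_one.indicator h2s) ?_
  simp_rw [lmarginal_singleton]
  ext x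
  cases t with | mk t_i t_j t_hij t_c =>
  simp [transvection, single_mulVec, t_hij.symm, ← Function.update_add,
    lintegral_add_right_eq_self fun xᵢ ↦ Set.indicator (Set.univ.pi s) 1 (Function.update x t_i xᵢ)]

/-- An invertible matrix is a product of diagonal matrices, which scale coordinate by coordinate,
and transvections, which preserve the measure by Fubini and translation invariance. -/
theorem ScalesByNorm.map_matrix [μ.IsAddRightInvariant] (hμ : ScalesByNorm μ) {M : Matrix ι ι K}
    (hM : det M ≠ 0) :
    (Measure.pi fun _ : ι => μ).map (toLin' M) =
      ENNReal.ofReal ‖det M‖⁻¹ • Measure.pi fun _ : ι => μ := by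
  apply diagonal_transvection_induction_of_det_ne_zero _ M hM
  · exact fun D hD => hμ.map_diagonal hD
  · intro t
    simp_rw [TransvectionStruct.det, norm_one, inv_one, ENNReal.ofReal_one, one_smul,
      (measurePreserving_transvectionStruct _).map_eq]
  · intro A B _ _ IHA IHB
    rw [toLin'_mul, det_mul, LinearMap.coe_comp, ← Measure.map_map, IHB, Measure.map_smul, IHA,
      smul_smul, ← ENNReal.ofReal_mul (by positivity), norm_mul, mul_comm, mul_inv]
    · exact measurable_toLin' _
    · exact measurable_toLin' _

theorem ScalesByNorm.measure_preimage_smul [μ.IsAddRightInvariant] (hμ : ScalesByNorm μ) {a : K}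
    (ha : a ≠ 0) {s : Set (ι → K)} (hs : MeasurableSet s) :
    Measure.pi (fun _ : ι => μ) ((a • ·) ⁻¹' s) =
      ENNReal.ofReal (‖a‖⁻¹ ^ Fintype.card ι) * Measure.pi (fun _ : ι => μ) s := by
  have hd : det (diagonal fun _ : ι => a) = a ^ Fintype.card ι := by simp [det_diagonal]
  have h := hμ.map_diagonal (ι := ι) (D := fun _ => a) (by rw [hd]; exact pow_ne_zero _ ha)
  have h1 := congrArg (fun ν => ν s) h
  simp only [Measure.smul_apply, smul_eq_mul, Measure.map_apply (measurable_toLin' _) hs, hd,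
    norm_pow] at h1
  rw [inv_pow, ← h1]
  congr 1
  ext x
  simp only [Set.mem_preimage, toLin'_apply]
  congr! 1
  funext i
  simp [mulVec_diagonal]

theorem ScalesByNorm.measure_norm_mulVec_sub_le [μ.IsAddHaarMeasure] (hμ : ScalesByNorm μ)
    {M : Matrix ι ι K} (hM : det M ≠ 0) (c : ι → K) {ε : ℝ} (hε : 0 ≤ ε) :
    Measure.pi (fun _ : ι => μ) {z | ‖M.mulVec (z - c)‖ ≤ ε} =
      ENNReal.ofReal ‖det M‖⁻¹ * μ (Metric.closedBall 0 ε) ^ Fintype.card ι := by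
  have h1 : {z | ‖M.mulVec (z - c)‖ ≤ ε} =
      (· + (-c)) ⁻¹' (toLin' M ⁻¹' Metric.closedBall 0 ε) := by
    ext z; simp [sub_eq_add_neg]
  rw [h1, measure_preimage_add_right, ← Measure.map_apply (measurable_toLin' _)
    Metric.isClosed_closedBall.measurableSet, hμ.map_matrix hM, Measure.smul_apply, smul_eq_mul,
    pi_closedBall _ hε]

end Scaling

/-! ### Fubini along the coordinate projection of a chart -/

section Glue

variable {K : Type*} {m N : ℕ}

open Classical in
/-- The point with coordinates `z` at the places `k` and `y` at the other places. -/
noncomputable def glue [Zero K] (k : Fin m ↪o Fin (N + 1)) (z : Fin m → K)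
    (y : {j : Fin (N + 1) // j ∉ Set.range k} → K) : Fin (N + 1) → K :=
  Function.extend k z fun j => if h : j ∉ Set.range k then y ⟨j, h⟩ else 0

variable [Zero K] (k : Fin m ↪o Fin (N + 1)) (z : Fin m → K)
    (y : {j : Fin (N + 1) // j ∉ Set.range k} → K)

theorem glue_apply (i : Fin m) : glue k z y (k i) = z i :=
  k.injective.extend_apply _ _ _

theorem glue_apply_of_notMem (j : {j : Fin (N + 1) // j ∉ Set.range k}) :
    glue k z y j = y j := by
  rw [glue, Function.extend_apply' _ _ _ fun ⟨a, ha⟩ => j.2 ⟨a, ha⟩, dif_pos j.2]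

theorem glue_comp : glue k z y ∘ k = z := funext fun i => glue_apply k z y i

theorem dropCoords_glue : dropCoords k (glue k z y) = y :=
  funext fun j => glue_apply_of_notMem k z y j

theorem measurable_glue [MeasurableSpace K] : Measurable fun p : (Fin m → K) × _ =>
    glue k p.1 p.2 := by
  refine measurable_pi_lambda _ fun j => ?_
  by_cases hj : j ∈ Set.range k
  · obtain ⟨i, rfl⟩ := hj
    simp only [glue_apply]
    exact (measurable_pi_apply i).comp measurable_fst
  · have : ∀ p : (Fin m → K) × _, glue k p.1 p.2 j = p.2 ⟨j, hj⟩ := fun p =>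
      glue_apply_of_notMem k p.1 p.2 ⟨j, hj⟩
    simp only [this]
    exact (measurable_pi_apply _).comp measurable_snd

theorem measurePreserving_glue [MeasurableSpace K] (μ : Measure K) [SigmaFinite μ] :
    MeasurePreserving (fun p : (Fin m → K) × _ => glue k p.1 p.2)
      ((Measure.pi fun _ => μ).prod (Measure.pi fun _ => μ)) (Measure.pi fun _ => μ) := by
  classical
  refine ⟨measurable_glue k, (Measure.pi_eq fun s hs => ?_).symm⟩
  rw [Measure.map_apply (measurable_glue k) (MeasurableSet.univ_pi hs)]
  have : (fun p : (Fin m → K) × _ => glue k p.1 p.2) ⁻¹' Set.pi Set.univ s =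
      (Set.pi Set.univ fun i => s (k i)) ×ˢ
        Set.pi Set.univ fun j : {j : Fin (N + 1) // j ∉ Set.range k} => s j := by
    ext p
    simp only [Set.mem_preimage, Set.mem_univ_pi, Set.mem_prod]
    refine ⟨fun h => ⟨fun i => glue_apply k p.1 p.2 i ▸ h (k i),
      fun j => glue_apply_of_notMem k p.1 p.2 j ▸ h j⟩, fun h j => ?_⟩
    by_cases hj : j ∈ Set.range k
    · obtain ⟨i, rfl⟩ := hj
      rw [glue_apply]; exact h.1 i
    · rw [glue_apply_of_notMem k p.1 p.2 ⟨j, hj⟩]; exact h.2 ⟨j, hj⟩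
  rw [this, Measure.prod_prod, Measure.pi_pi, Measure.pi_pi,
    ← Fintype.prod_subtype_mul_prod_subtype (fun j => j ∈ Set.range k) fun j => μ (s j)]
  congr 1
  convert Fintype.prod_equiv (Equiv.ofInjective k k.injective) (fun i => μ (s (k i)))
    (fun j => μ (s j)) fun _ => rfl

theorem measure_eq_lintegral_glue [MeasurableSpace K] (μ : Measure K) [SigmaFinite μ]
    {E : Set (Fin (N + 1) → K)} (hE : MeasurableSet E) :
    Measure.pi (fun _ => μ) E =
      ∫⁻ y, Measure.pi (fun _ => μ) {z : Fin m → K | glue k z y ∈ E}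
        ∂Measure.pi fun _ : {j : Fin (N + 1) // j ∉ Set.range k} => μ := by
  rw [← (measurePreserving_glue k μ).measure_preimage hE.nullMeasurableSet,
    Measure.prod_apply_symm (measurable_glue k hE)]
  rfl

end Glue

/-! ### Primitive approximate zeros, fibre by fibre over a chart -/

section Fibre

open MvPolynomial

variable {R : Type*} [CommRing R] {m N : ℕ} {K : Type*} [NontriviallyNormedField K]
  [Algebra R K]

/-- The approximate zeros of `f` of norm one in the chart `k`. -/
def chartNear (f : Fin m → MvPolynomial (Fin (N + 1)) R) (k : Fin m ↪o Fin (N + 1)) (ε : ℝ) :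
    Set (Fin (N + 1) → K) :=
  {x | ‖x‖ = 1 ∧ ‖fun i => aeval x (f i)‖ ≤ ε ∧ ChartAt f k x}

/-- The zeros of `f` of norm one in the chart `k` over the point `y`. -/
def chartRoots (f : Fin m → MvPolynomial (Fin (N + 1)) R) (k : Fin m ↪o Fin (N + 1))
    (y : {j : Fin (N + 1) // j ∉ Set.range k} → K) : Set (Fin (N + 1) → K) :=
  {x | ‖x‖ = 1 ∧ (∀ i, aeval x (f i) = 0) ∧ ChartAt f k x ∧ dropCoords k x = y}

/-- At every approximate zero of norm one up to `e`, some minor has norm at least `e`. -/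
def MinorBound (K : Type*) [NormedField K] [Algebra R K]
    (f : Fin m → MvPolynomial (Fin (N + 1)) R) (e : ℝ) : Prop :=
  ∀ x : Fin (N + 1) → K, ‖x‖ = 1 → ‖fun i => aeval x (f i)‖ < e → ∃ k, e ≤ ‖minor f k x‖

variable {f : Fin m → MvPolynomial (Fin (N + 1)) R} {k : Fin m ↪o Fin (N + 1)} {e ε : ℝ}

theorem ChartAt.le_norm_minor (h : MinorBound K f e) {x : Fin (N + 1) → K} (hx : ‖x‖ = 1)
    (hf : ‖fun i => aeval x (f i)‖ < e) (hc : ChartAt f k x) : e ≤ ‖minor f k x‖ := by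
  obtain ⟨k', hk'⟩ := h x hx hf
  exact hk'.trans (hc.norm_minor_le k')

/-- The approximate zeros close to the zero `x`. -/
def nearRoot (f : Fin m → MvPolynomial (Fin (N + 1)) R) (k : Fin m ↪o Fin (N + 1)) (ε : ℝ)
    (x : Fin (N + 1) → K) : Set (Fin m → K) :=
  {z | ‖(jacobian f k x).mulVec (z - x ∘ k)‖ ≤ ε}

theorem norm_eq_zero_of_root {x : Fin (N + 1) → K} (hx : ∀ i, aeval x (f i) = 0) :
    ‖fun i => aeval x (f i)‖ = 0 := norm_eq_zero.2 (funext hx)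

theorem chartRoots_le_norm_minor (h : MinorBound K f e) (he : 0 < e)
    {y : {j : Fin (N + 1) // j ∉ Set.range k} → K} {x : Fin (N + 1) → K}
    (hx : x ∈ chartRoots f k y) : e ≤ ‖minor f k x‖ :=
  hx.2.2.1.le_norm_minor h hx.1 (by rw [norm_eq_zero_of_root hx.2.1]; exact he)

/-- Identifies the integrand of the Leray measure, restricted to primitive points, with the sum that
the fibre volumes produce. -/
theorem tsum_chartRoots (y : {j : Fin (N + 1) // j ∉ Set.range k} → K) :
    ∑' x : {x : coneSet K f // x ∈ chartPiece f k ∧ dropCoords k x.1 = y},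
        ENNReal.ofReal ‖minor f k x.1.1‖⁻¹ *
          {x : coneSet K f | ‖x.1‖ = 1}.indicator 1 x.1 =
      ∑' x : chartRoots f k y, ENNReal.ofReal ‖minor f k x.1‖⁻¹ := by
  let j : chartRoots f k y → {x : coneSet K f // x ∈ chartPiece f k ∧ dropCoords k x.1 = y} :=
    fun x => ⟨⟨x.1, fun h0 => by simpa [h0] using x.2.1, x.2.2.1⟩, x.2.2.2.1, x.2.2.2.2⟩
  have hj : Function.Injective j := fun a b hab => Subtype.ext
    (congrArg (fun x : {x : coneSet K f // x ∈ chartPiece f k ∧ dropCoords k x.1 = y} => x.1.1)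
      hab)
  rw [← hj.tsum_eq]
  · refine tsum_congr fun x => ?_
    rw [Set.indicator_of_mem (show (j x).1 ∈ {x : coneSet K f | ‖x.1‖ = 1} from x.2.1)]
    simp [j]
  · intro x hx
    have h1 : ‖x.1.1‖ = 1 := by
      by_contra h1
      refine hx ?_
      simp only
      rw [Set.indicator_of_notMem (show x.1 ∉ {x : coneSet K f | ‖x.1‖ = 1} from h1), mul_zero]
    exact ⟨⟨x.1.1, h1, x.1.2.2, x.2.1, x.2.2⟩, rfl⟩

section Measurable

variable [MeasurableSpace K] [BorelSpace K] [SecondCountableTopology K]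

theorem measurableSet_nearRoot (x : Fin (N + 1) → K) : MeasurableSet (nearRoot f k ε x) := by
  have : Continuous fun z : Fin m → K => (jacobian f k x).mulVec (z - x ∘ k) :=
    Continuous.matrix_mulVec continuous_const (continuous_id.sub continuous_const)
  exact (isClosed_le this.norm continuous_const).measurableSet

theorem measurableSet_chartNear [ProperSpace K] :
    MeasurableSet (chartNear f k ε : Set (Fin (N + 1) → K)) := by
  have hm : ∀ k' : Fin m ↪o Fin (N + 1), Measurable (minor (K := K) f k') := fun k' =>
    (continuous_minor f k').measurable
  have h1 : MeasurableSet {x : Fin (N + 1) → K | ‖x‖ = 1} :=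
    (isClosed_eq continuous_norm continuous_const).measurableSet
  have h2 : MeasurableSet {x : Fin (N + 1) → K | ‖fun i => aeval x (f i)‖ ≤ ε} :=
    (isClosed_le (continuous_pi fun i => continuous_aeval_point (f i)).norm
      continuous_const).measurableSet
  have h3 : {x : Fin (N + 1) → K | ChartAt f k x} = {x | minor f k x = 0}ᶜ ∩
      ⋂ k' : Fin m ↪o Fin (N + 1), ({x | ‖minor f k' x‖ < ‖minor f k x‖} ∪
      ({x | ‖minor f k' x‖ = ‖minor f k x‖} ∩
        {_x | toLex (k : Fin m → Fin (N + 1)) ≤ toLex (k' : Fin m → Fin (N + 1))})) := by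
    ext; simp [ChartAt]
  refine h1.inter (h2.inter ?_)
  change MeasurableSet {x : Fin (N + 1) → K | ChartAt f k x}
  rw [h3]
  refine ((hm k) (measurableSet_singleton 0)).compl.inter (MeasurableSet.iInter fun k' => ?_)
  exact (measurableSet_lt (hm k').norm (hm k).norm).union
    ((measurableSet_eq_fun (hm k').norm (hm k).norm).inter (MeasurableSet.const _))

theorem measurableSet_norm_eq (c : ℝ) :
    MeasurableSet {x : coneSet K f | ‖x.1‖ = c} :=
  (isClosed_eq (continuous_norm.comp continuous_subtype_val) continuous_const).measurableSet

end Measurable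

variable [IsUltrametricDist K]

theorem norm_glue_sub_le (hR : ∀ a : R, ‖algebraMap R K a‖ ≤ 1) (h : MinorBound K f e)
    (he : 0 < e) {y : {j : Fin (N + 1) // j ∉ Set.range k} → K} {x : Fin (N + 1) → K}
    (hx : x ∈ chartRoots f k y) {z : Fin m → K} (hz : z ∈ nearRoot f k ε x) :
    ‖glue k z y - x‖ ≤ ε / ‖minor f k x‖ := by
  have hpos : 0 < ‖minor f k x‖ := he.trans_le (chartRoots_le_norm_minor h he hx)
  rw [norm_sub_eq_norm_comp (k := k) (by rw [dropCoords_glue, hx.2.2.2]), le_div_iff₀ hpos,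
    mul_comm]
  have h1 : (glue k z y - x) ∘ k = z - x ∘ k := by
    funext i; simp [glue_apply]
  rw [h1]
  exact (norm_minor_mul_norm_le hR f k hx.1.le _).trans hz

theorem div_lt_of_lt_sq {ε e δ : ℝ} (he : 0 < e) (h : ε < e ^ 2) (hδ : e ≤ δ) : ε / δ < δ := by
  rw [div_lt_iff₀ (he.trans_le hδ), ← sq]
  exact h.trans_le (by gcongr)

/-- Hensel's lemma supplies a true zero within `ε / ‖minor‖` of each approximate zero. That distance
is less than the minor itself, so norm one and the chart carry over in both directions, and near the
zero `f` may be linearized. -/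
theorem setOf_glue_mem_chartNear [ProperSpace K] (hR : ∀ a : R, ‖algebraMap R K a‖ ≤ 1)
    (h : MinorBound K f e) (he : 0 < e) (hε : ε < e) (hε2 : ε < e ^ 2)
    (y : {j : Fin (N + 1) // j ∉ Set.range k} → K) :
    {z | glue k z y ∈ chartNear f k ε} = ⋃ x ∈ chartRoots f k y, nearRoot f k ε x := by
  ext z
  simp only [Set.mem_ofPred_eq, Set.mem_iUnion, exists_prop]
  have hcomp : ∀ x, (glue k z y - x) ∘ k = z - x ∘ k := fun x => by
    funext i; simp [glue_apply]
  constructor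
  · rintro ⟨h1, h2, h3⟩
    have hδ := h3.le_norm_minor h h1 (h2.trans_lt hε)
    have hlt := div_lt_of_lt_sq he hε2 hδ
    obtain ⟨x, hxd, hxn, hx0⟩ := exists_root_of_norm_lt hR f k h1.le h2
      (hε2.trans_le (by gcongr))
    have hlt' := hxn.trans_lt hlt
    have hx1 : ‖x‖ = 1 := by
      rw [← h1]
      exact norm_eq_of_norm_sub_lt (by
        rw [h1]; exact hlt'.trans_le (norm_minor_le_one hR f k h1.le))
    refine ⟨x, ⟨hx1, hx0, h3.of_norm_sub_lt hR h1.le hx1.le hlt', ?_⟩, ?_⟩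
    · rw [hxd, dropCoords_glue]
    -- With `δ` the minor at the approximate zero, `ε / δ < δ` gives `(ε / δ)² ≤ ε`, so the
    -- quadratic error is harmless.
    · have := norm_aeval_le_iff_of_root hR f hx1.le h1.le hxd.symm hx0 (ε := ε) (by
        rw [norm_sub_rev]
        calc ‖x - glue k z y‖ ^ 2 ≤ (ε / ‖minor f k (glue k z y)‖) ^ 2 := by gcongr
          _ ≤ ε := by
            have hε0 : 0 ≤ ε := (norm_nonneg _).trans h2
            have hpos := he.trans_le hδ
            rw [sq, mul_div_assoc', div_le_iff₀ hpos, mul_comm]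
            exact mul_le_mul_of_nonneg_left hlt.le hε0)
      rw [hcomp] at this
      exact this.1 h2
  · rintro ⟨x, hx, hz⟩
    have hδ := chartRoots_le_norm_minor h he hx
    have hlt := div_lt_of_lt_sq he hε2 hδ
    have hn := norm_glue_sub_le hR h he hx hz
    have hlt' := hn.trans_lt hlt
    have h1 : ‖glue k z y‖ = 1 := by
      rw [← hx.1]
      exact norm_eq_of_norm_sub_lt (by
        rw [hx.1]; exact hlt'.trans_le (norm_minor_le_one hR f k hx.1.le))
    refine ⟨h1, ?_, hx.2.2.1.of_norm_sub_lt hR hx.1.le h1.le hlt'⟩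
    have := norm_aeval_le_iff_of_root hR f hx.1.le h1.le
      ((dropCoords_glue k z y).trans hx.2.2.2.symm) hx.2.1 (ε := ε) (by
        calc ‖glue k z y - x‖ ^ 2 ≤ (ε / ‖minor f k x‖) ^ 2 := by gcongr
          _ ≤ ε := by
            have hε0 : 0 ≤ ε := (norm_nonneg _).trans hz
            have hpos := he.trans_le hδ
            rw [sq, mul_div_assoc', div_le_iff₀ hpos, mul_comm]
            exact mul_le_mul_of_nonneg_left hlt.le hε0)
    rw [hcomp] at this
    exact this.2 hz

/-- A common point would lie closer to each root than the minor there. Both minors then have the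
norm of the minor at the common point, so the two roots are closer than that norm and coincide by
`root_unique`. -/
theorem pairwiseDisjoint_nearRoot (hR : ∀ a : R, ‖algebraMap R K a‖ ≤ 1) (h : MinorBound K f e)
    (he : 0 < e) (hε2 : ε < e ^ 2)
    (y : {j : Fin (N + 1) // j ∉ Set.range k} → K) :
    (chartRoots f k y).PairwiseDisjoint (nearRoot f k ε) := by
  intro x hx x' hx' hne
  refine Set.disjoint_left.2 fun z hz hz' => hne ?_
  have h1 := (norm_glue_sub_le hR h he hx hz).trans_lt
    (div_lt_of_lt_sq he hε2 (chartRoots_le_norm_minor h he hx))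
  have h1' := (norm_glue_sub_le hR h he hx' hz').trans_lt
    (div_lt_of_lt_sq he hε2 (chartRoots_le_norm_minor h he hx'))
  have hg : ‖glue k z y‖ ≤ 1 := by
    have := norm_add_le_of_le_of_le (h1.le.trans (norm_minor_le_one hR f k hx.1.le)) hx.1.le
    rwa [sub_add_cancel] at this
  have e1 := norm_minor_eq hR hx.1.le hg h1
  have e2 := norm_minor_eq hR hx'.1.le hg h1'
  refine root_unique hR f hx'.1.le hx.1.le (hx.2.2.2.trans hx'.2.2.2.symm) hx'.2.1 hx.2.1 ?_
  rw [← sub_add_sub_cancel x (glue k z y) x']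
  refine (IsUltrametricDist.norm_add_le_max _ _).trans_lt (max_lt ?_ h1')
  rw [norm_sub_rev, ← e2, e1]
  exact h1

variable [ProperSpace K] [MeasurableSpace K] [BorelSpace K] [SecondCountableTopology K]
  {μ : Measure K} [μ.IsAddHaarMeasure]

theorem measure_setOf_glue_mem_chartNear (hμ : ScalesByNorm μ)
    (hR : ∀ a : R, ‖algebraMap R K a‖ ≤ 1) (h : MinorBound K f e)
    (he : 0 < e) (hε0 : 0 < ε) (hε : ε < e) (hε2 : ε < e ^ 2)
    (y : {j : Fin (N + 1) // j ∉ Set.range k} → K) :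
    Measure.pi (fun _ => μ) {z | glue k z y ∈ chartNear f k ε} =
      μ (Metric.closedBall 0 ε) ^ m *
        ∑' x : chartRoots f k y, ENNReal.ofReal ‖minor f k x.1‖⁻¹ := by
  -- Each root has a neighbourhood with nonempty interior, as `ε > 0`. Disjoint such sets are
  -- countably many in a second countable space, which allows countable additivity.
  have hc : (chartRoots f k y).Countable := by
    refine (pairwiseDisjoint_nearRoot hR h he hε2 y).countable_of_nonempty_interior fun x hx => ?_
    refine ⟨x ∘ k, mem_interior_iff_mem_nhds.2 ?_⟩
    have : Continuous fun z : Fin m → K => ‖(jacobian f k x).mulVec (z - x ∘ k)‖ :=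
      (Continuous.matrix_mulVec continuous_const (continuous_id.sub continuous_const)).norm
    filter_upwards [(isOpen_lt this continuous_const).mem_nhds
      (show x ∘ k ∈ {z | ‖(jacobian f k x).mulVec (z - x ∘ k)‖ < ε} by simpa using hε0)]
      with z hz using le_of_lt hz
  rw [setOf_glue_mem_chartNear hR h he hε hε2, measure_biUnion hc
    (pairwiseDisjoint_nearRoot hR h he hε2 y) fun x _ => measurableSet_nearRoot x,
    ← ENNReal.tsum_mul_left]
  refine tsum_congr fun x => ?_
  have := hμ.measure_norm_mulVec_sub_le (M := jacobian f k x.1) x.2.2.2.1.1 (x.1 ∘ k) hε0.le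
  rw [Fintype.card_fin] at this
  rw [nearRoot, this, mul_comm, det_jacobian]

/-- The approximate zeros of norm one have, up to normalization, the same measure as the zeros of
norm one. -/
theorem measure_norm_eq_one_near (hμ : ScalesByNorm μ)
    (hR : ∀ a : R, ‖algebraMap R K a‖ ≤ 1) (h : MinorBound K f e)
    (he : 0 < e) (hε0 : 0 < ε) (hε : ε < e) (hε2 : ε < e ^ 2) :
    Measure.pi (fun _ => μ) {x : Fin (N + 1) → K | ‖x‖ = 1 ∧ ‖fun i => aeval x (f i)‖ ≤ ε} =
      μ (Metric.closedBall 0 ε) ^ m * lerayMeasure f μ {x : coneSet K f | ‖x.1‖ = 1} := by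
  have h1 : {x : Fin (N + 1) → K | ‖x‖ = 1 ∧ ‖fun i => aeval x (f i)‖ ≤ ε} =
      ⋃ k, chartNear f k ε := by
    ext x
    simp only [Set.mem_ofPred_eq, Set.mem_iUnion, chartNear]
    refine ⟨fun hx => ?_, fun ⟨k, hk⟩ => ⟨hk.1, hk.2.1⟩⟩
    obtain ⟨k, hk⟩ := h x hx.1 (hx.2.trans_lt hε)
    obtain ⟨k', hk'⟩ := exists_chartAt ⟨k, norm_pos_iff.1 (he.trans_le hk)⟩
    exact ⟨k', hx.1, hx.2, hk'⟩
  have hd : Pairwise (Function.onFun Disjoint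
      fun k => (chartNear f k ε : Set (Fin (N + 1) → K))) := fun k k' hne =>
    Set.disjoint_left.2 fun x hx hx' => hne (hx.2.2.unique hx'.2.2)
  rw [h1, measure_iUnion hd fun k => measurableSet_chartNear, tsum_fintype,
    lerayMeasure_apply f μ (measurableSet_norm_eq 1), Finset.mul_sum]
  refine Finset.sum_congr rfl fun k _ => ?_
  rw [measure_eq_lintegral_glue k μ measurableSet_chartNear,
    ← lintegral_const_mul' _ _ (ENNReal.pow_ne_top (measure_closedBall_lt_top.ne))]
  refine lintegral_congr fun y => ?_
  rw [measure_setOf_glue_mem_chartNear hμ hR h he hε0 hε hε2, tsum_chartRoots]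

end Fibre

/-! ### Homogeneity of the Leray measure -/

section Homogeneous

open MvPolynomial

theorem aeval_smul_of_isHomogeneous {R σ K : Type*} [CommRing R] [Fintype σ] [CommRing K]
    [Algebra R K] {p : MvPolynomial σ R} {d : ℕ} (hp : p.IsHomogeneous d) (a : K) (x : σ → K) :
    aeval (a • x) p = a ^ d * aeval x p := by
  rw [aeval_def, aeval_def, eval₂_eq', eval₂_eq', Finset.mul_sum]
  refine Finset.sum_congr rfl fun c hc => ?_
  have h1 : ∑ i, c i = d := by
    have := hp (mem_support_iff.1 hc)
    rw [Finsupp.weight_apply, Finsupp.sum_fintype _ _ (by simp)] at this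
    simpa using this
  simp only [Pi.smul_apply, smul_eq_mul, mul_pow, Finset.prod_mul_distrib]
  rw [Finset.prod_pow_eq_pow_sum, h1]
  ring

variable {R : Type*} [CommRing R] {m N d : ℕ} {K : Type*} [NontriviallyNormedField K]
  [Algebra R K] {f : Fin m → MvPolynomial (Fin (N + 1)) R} {k : Fin m ↪o Fin (N + 1)}

theorem minor_smul (hf : ∀ i, (f i).IsHomogeneous d) (a : K) (x : Fin (N + 1) → K) :
    minor f k (a • x) = a ^ (m * (d - 1)) * minor f k x := by
  have : (Matrix.of fun i j : Fin m => aeval (a • x) (pderiv (k j) (f i))) =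
      a ^ (d - 1) • Matrix.of fun i j : Fin m => aeval x (pderiv (k j) (f i)) := by
    ext i j
    simp [aeval_smul_of_isHomogeneous (hf i).pderiv]
  rw [minor, this, Matrix.det_smul, Fintype.card_fin, ← pow_mul, mul_comm (d - 1), minor]

theorem chartAt_smul (hf : ∀ i, (f i).IsHomogeneous d) {a : K} (ha : a ≠ 0)
    {x : Fin (N + 1) → K} (hx : ChartAt f k x) : ChartAt f k (a • x) := by
  have h0 : 0 < ‖a ^ (m * (d - 1))‖ := norm_pos_iff.2 (pow_ne_zero _ ha)
  refine ⟨?_, fun k' => ?_⟩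
  · rw [minor_smul hf]; exact mul_ne_zero (pow_ne_zero _ ha) hx.1
  · rw [minor_smul hf, minor_smul hf, norm_mul, norm_mul]
    exact (hx.2 k').imp (fun h => mul_lt_mul_of_pos_left h h0) fun h => ⟨by rw [h.1], h.2⟩

theorem smul_mem_coneSet (hf : ∀ i, (f i).IsHomogeneous d) {a : K} (ha : a ≠ 0)
    {x : Fin (N + 1) → K} (hx : x ∈ coneSet K f) : a • x ∈ coneSet K f :=
  ⟨smul_ne_zero ha hx.1, fun i => by rw [aeval_smul_of_isHomogeneous (hf i), hx.2 i, mul_zero]⟩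

/-- Scaling of the points of a chart over a given point. -/
def chartFibreEquiv (hf : ∀ i, (f i).IsHomogeneous d) {a : K} (ha : a ≠ 0)
    (y : {j : Fin (N + 1) // j ∉ Set.range k} → K) :
    {x : coneSet K f // x ∈ chartPiece f k ∧ dropCoords k x.1 = y} ≃
      {x : coneSet K f // x ∈ chartPiece f k ∧ dropCoords k x.1 = a • y} where
  toFun x := ⟨⟨a • x.1.1, smul_mem_coneSet hf ha x.1.2⟩, chartAt_smul hf ha x.2.1,
    congrArg (a • ·) x.2.2⟩
  invFun x := ⟨⟨a⁻¹ • x.1.1, smul_mem_coneSet hf (inv_ne_zero ha) x.1.2⟩,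
    chartAt_smul hf (inv_ne_zero ha) x.2.1,
    (congrArg (a⁻¹ • ·) x.2.2).trans (inv_smul_smul₀ ha y)⟩
  left_inv x := by ext : 2; exact inv_smul_smul₀ ha _
  right_inv x := by ext : 2; exact smul_inv_smul₀ ha _

variable [MeasurableSpace K] [BorelSpace K] [SecondCountableTopology K] {μ : Measure K}

theorem ScalesByNorm.lintegral_eq_smul [SigmaFinite μ] [μ.IsAddRightInvariant] {ι : Type*}
    [Fintype ι] (hμ : ScalesByNorm μ) {a : K} (ha : a ≠ 0) (g : (ι → K) → ℝ≥0∞) :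
    ∫⁻ y, g y ∂Measure.pi (fun _ => μ) =
      ENNReal.ofReal (‖a‖ ^ Fintype.card ι) * ∫⁻ y, g (a • y) ∂Measure.pi (fun _ => μ) := by
  classical
  have he : MeasurableEmbedding (fun y : ι → K => a • y) :=
    (Homeomorph.smulOfNeZero a ha).isClosedEmbedding.measurableEmbedding
  have hmap : (Measure.pi fun _ : ι => μ).map (a • ·) =
      ENNReal.ofReal (‖a‖⁻¹ ^ Fintype.card ι) • Measure.pi fun _ : ι => μ := by
    ext s hs
    rw [he.map_apply, hμ.measure_preimage_smul ha hs, Measure.smul_apply, smul_eq_mul]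
  rw [← he.lintegral_map g, hmap, lintegral_smul_measure, smul_eq_mul, ← mul_assoc,
    ← ENNReal.ofReal_mul (by positivity), ← mul_pow, mul_inv_cancel₀ (norm_ne_zero_iff.2 ha),
    one_pow, ENNReal.ofReal_one, one_mul]

theorem card_notMem_range (k : Fin m ↪o Fin (N + 1)) :
    Fintype.card {j : Fin (N + 1) // j ∉ Set.range k} = N + 1 - m := by
  classical
  rw [Fintype.card_subtype_compl, Fintype.card_fin]
  congr 1
  exact (Fintype.card_congr (Equiv.ofInjective k k.injective)).symm.trans (Fintype.card_fin m)

/-- The Leray measure is homogeneous of degree `N + 1 - m d`. -/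
theorem lerayMeasure_norm_eq [ProperSpace K] [μ.IsAddHaarMeasure] (hμ : ScalesByNorm μ)
    (hd : 1 ≤ d) (hf : ∀ i, (f i).IsHomogeneous d) (hδ : m * d < N + 1) {a : K} (ha : a ≠ 0) :
    lerayMeasure f μ {x : coneSet K f | ‖x.1‖ = ‖a‖} =
      ENNReal.ofReal (‖a‖ ^ (N + 1 - m * d)) *
        lerayMeasure f μ {x : coneSet K f | ‖x.1‖ = 1} := by
  have hna : ‖a‖ ≠ 0 := norm_ne_zero_iff.2 ha
  rw [lerayMeasure_apply f μ (measurableSet_norm_eq _),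
    lerayMeasure_apply f μ (measurableSet_norm_eq _), Finset.mul_sum]
  refine Finset.sum_congr rfl fun k _ => ?_
  rw [hμ.lintegral_eq_smul ha, ← lintegral_const_mul' _ _ ENNReal.ofReal_ne_top,
    ← lintegral_const_mul' _ _ ENNReal.ofReal_ne_top]
  refine lintegral_congr fun y => ?_
  rw [← (chartFibreEquiv hf ha y).tsum_eq, ← ENNReal.tsum_mul_left, ← ENNReal.tsum_mul_left]
  refine tsum_congr fun x => ?_
  have h1 : ((chartFibreEquiv hf ha y) x).1.1 = a • x.1.1 := rfl
  have h2 : {x : coneSet K f | ‖x.1‖ = ‖a‖}.indicator (1 : coneSet K f → ℝ≥0∞)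
      ((chartFibreEquiv hf ha y) x).1 = {x : coneSet K f | ‖x.1‖ = 1}.indicator 1 x.1 := by
    simp only [Set.indicator_apply, Set.mem_ofPred_eq, h1, norm_smul, mul_eq_left₀ hna]
    rfl
  rw [h2, ← mul_assoc, ← mul_assoc, h1, minor_smul hf, card_notMem_range,
    ← ENNReal.ofReal_mul (by positivity), ← ENNReal.ofReal_mul (by positivity), norm_mul, norm_pow,
    mul_inv, ← mul_assoc]
  congr 3
  -- The `N + 1 - m` chart coordinates contribute `‖a‖^(N+1-m)` and the inverse minor
  -- `‖a‖^(-m(d-1))`; the exponents add up to `N + 1 - m d`. The hypotheses `1 ≤ d` and `m d < N +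
  -- 1` make the natural subtractions genuine.
  rw [← div_eq_mul_inv, div_eq_iff (pow_ne_zero _ hna), ← pow_add]
  congr 1
  obtain ⟨c, rfl⟩ := Nat.exists_eq_add_of_le hd
  have : m * (1 + c) = m + m * c := by ring
  rw [this] at hδ ⊢
  simp only [Nat.add_sub_cancel_left]
  omega

/-- The sup norm of a nonzero point is attained at a coordinate, hence is a power of `‖a‖`. The
integral points are thus a disjoint union of shells whose masses form a geometric series. -/
theorem lerayMeasure_norm_le_one [ProperSpace K] [μ.IsAddHaarMeasure] (hμ : ScalesByNorm μ)
    (hd : 1 ≤ d) (hf : ∀ i, (f i).IsHomogeneous d) (hδ : m * d < N + 1) {a : K} (ha : a ≠ 0)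
    (ha1 : ‖a‖ < 1) (hgen : ∀ b : K, b ≠ 0 → ‖b‖ ≤ 1 → ∃ n : ℕ, ‖b‖ = ‖a‖ ^ n) :
    lerayMeasure f μ {x : coneSet K f | ‖x.1‖ ≤ 1} =
      (1 - ENNReal.ofReal (‖a‖ ^ (N + 1 - m * d)))⁻¹ *
        lerayMeasure f μ {x : coneSet K f | ‖x.1‖ = 1} := by
  have h1 : {x : coneSet K f | ‖x.1‖ ≤ 1} = ⋃ n : ℕ, {x : coneSet K f | ‖x.1‖ = ‖a ^ n‖} := by
    ext x
    simp only [Set.mem_ofPred_eq, Set.mem_iUnion, norm_pow]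
    constructor
    · intro hx
      obtain ⟨i, -, hi⟩ := Finset.exists_max_image Finset.univ (fun i => ‖x.1 i‖)
        ⟨0, Finset.mem_univ _⟩
      have hi' : ‖x.1‖ = ‖x.1 i‖ := le_antisymm
        ((pi_norm_le_iff_of_nonneg (norm_nonneg _)).2 fun j => hi j (Finset.mem_univ _))
        (norm_le_pi_norm x.1 i)
      rw [hi'] at hx ⊢
      exact hgen _ (norm_ne_zero_iff.1 (hi' ▸ norm_ne_zero_iff.2 x.2.1)) hx
    · rintro ⟨n, hn⟩
      rw [hn]
      exact pow_le_one₀ (norm_nonneg _) ha1.le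
  rw [h1, measure_iUnion]
  · simp only [lerayMeasure_norm_eq hμ hd hf hδ (pow_ne_zero _ ha)]
    rw [ENNReal.tsum_mul_right, ← ENNReal.tsum_geometric]
    congr 2
    funext n
    rw [norm_pow, ← ENNReal.ofReal_pow (by positivity), ← pow_mul, ← pow_mul, mul_comm]
  · intro n n' hne
    refine Set.disjoint_left.2 fun x (hx : _ = _) (hx' : _ = _) => hne ?_
    rw [hx, norm_pow, norm_pow] at hx'
    exact pow_right_injective₀ (norm_pos_iff.2 ha) ha1.ne hx'
  · exact fun n => measurableSet_norm_eq _

end Homogeneous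

/-! ### An affine recurrence with step `d` -/

section Recurrence

/-- The distance to the fixed point of `x ↦ p + t x` contracts by `t` every `d` steps. The `d`
residue classes are controlled together by the sum `C` of their initial distances. -/
theorem tendsto_of_recurrence {u : ℕ → ℝ} {p t : ℝ} {d r₀ : ℕ} (hd : 1 ≤ d) (ht0 : 0 ≤ t)
    (ht1 : t < 1) (hu : ∀ r, r₀ ≤ r → u (r + d) = p + t * u r) :
    Tendsto u atTop (𝓝 ((1 - t)⁻¹ * p)) := by
  set L := (1 - t)⁻¹ * p with hL
  have hLp : L = p + t * L := by
    have : 1 - t ≠ 0 := by linarith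
    rw [hL]; field_simp; ring
  have h1 : ∀ q s, u (r₀ + s + q * d) - L = t ^ q * (u (r₀ + s) - L) := by
    intro q s
    induction q with
    | zero => simp
    | succ q ih =>
      rw [show r₀ + s + (q + 1) * d = r₀ + s + q * d + d by ring, hu _ (by omega), pow_succ']
      linear_combination t * ih - hLp
  let C : ℝ := ∑ s ∈ Finset.range d, |u (r₀ + s) - L|
  have h2 : ∀ n, |u (n + r₀) - L| ≤ t ^ (n / d) * C := by
    intro n
    have h3 : n + r₀ = r₀ + n % d + n / d * d := by
      have := Nat.mod_add_div n d
      rw [mul_comm] at this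
      omega
    rw [h3, h1, abs_mul, abs_of_nonneg (by positivity)]
    gcongr
    exact Finset.single_le_sum (f := fun s => |u (r₀ + s) - L|) (fun _ _ => abs_nonneg _)
      (Finset.mem_range.2 (Nat.mod_lt _ hd))
  rw [← tendsto_add_atTop_iff_nat r₀, tendsto_iff_norm_sub_tendsto_zero]
  refine squeeze_zero (fun _ => norm_nonneg _) h2 ?_
  rw [← zero_mul C]
  exact ((tendsto_pow_atTop_nhds_zero_of_lt_one ht0 ht1).comp
    (Nat.tendsto_div_const_atTop (by omega))).mul_const C

end Recurrence

/-! ### The limit of the volumes of integral approximate zeros -/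

section Density

open MvPolynomial

variable {R : Type*} [CommRing R] {m N d : ℕ} {K : Type*} [NontriviallyNormedField K]
  [Algebra R K] {f : Fin m → MvPolynomial (Fin (N + 1)) R} {e : ℝ}

/-- The integral approximate zeros of `f`. -/
def nearZeros (K : Type*) [NormedField K] [Algebra R K]
    (f : Fin m → MvPolynomial (Fin (N + 1)) R) (ε : ℝ) : Set (Fin (N + 1) → K) :=
  {x | ‖x‖ ≤ 1 ∧ ‖fun i => aeval x (f i)‖ ≤ ε}

theorem ScalesByNorm.measure_closedBall [MeasurableSpace K] {μ : Measure K} (hμ : ScalesByNorm μ)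
    (h1 : μ (Metric.closedBall 0 1) = 1) {a : K} (ha : a ≠ 0) :
    μ (Metric.closedBall 0 ‖a‖) = ENNReal.ofReal ‖a‖ := by
  have : Metric.closedBall 0 ‖a‖ = (a⁻¹ * ·) ⁻¹' Metric.closedBall (0 : K) 1 := by
    ext x
    simp [inv_mul_le_iff₀ (norm_pos_iff.2 ha)]
  rw [this, hμ _ (inv_ne_zero ha), h1, norm_inv, inv_inv, mul_one]

theorem isClosed_nearZeros (ε : ℝ) : IsClosed (nearZeros K f ε) :=
  (isClosed_le continuous_norm continuous_const).inter
    (isClosed_le (continuous_pi fun i => continuous_aeval_point (f i)).norm continuous_const)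

variable [ProperSpace K] [SecondCountableTopology K] [MeasurableSpace K] {μ : Measure K}
  [μ.IsAddHaarMeasure]

theorem measure_nearZeros_ne_top (ε : ℝ) :
    Measure.pi (fun _ => μ) (nearZeros K f ε) ≠ ∞ := by
  refine ne_top_of_le_ne_top (measure_closedBall_lt_top (x := (0 : Fin (N + 1) → K)) (r := 1)).ne
    (measure_mono fun x hx => ?_)
  simpa using hx.1

variable [BorelSpace K]

theorem measure_nearZeros_smul (hμ : ScalesByNorm μ) (hf : ∀ i, (f i).IsHomogeneous d) {a : K}
    (ha : a ≠ 0) (ε : ℝ) :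
    Measure.pi (fun _ => μ)
      {x : Fin (N + 1) → K | ‖x‖ ≤ ‖a‖ ∧ ‖fun i => aeval x (f i)‖ ≤ ‖a‖ ^ d * ε} =
      ENNReal.ofReal (‖a‖ ^ (N + 1)) * Measure.pi (fun _ => μ) (nearZeros K f ε) := by
  have h0 := norm_pos_iff.2 ha
  have h1 : {x : Fin (N + 1) → K | ‖x‖ ≤ ‖a‖ ∧ ‖fun i => aeval x (f i)‖ ≤ ‖a‖ ^ d * ε} =
      (a⁻¹ • ·) ⁻¹' nearZeros K f ε := by
    ext x
    have h2 : (fun i => aeval (a⁻¹ • x) (f i)) = (a⁻¹) ^ d • fun i => aeval x (f i) := by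
      funext i
      simp [aeval_smul_of_isHomogeneous (hf i)]
    simp only [Set.mem_ofPred_eq, Set.mem_preimage, nearZeros, h2, norm_smul, norm_pow, norm_inv,
      inv_pow]
    rw [inv_mul_le_iff₀ h0, inv_mul_le_iff₀ (by positivity), mul_one]
  rw [h1, hμ.measure_preimage_smul (inv_ne_zero ha) (isClosed_nearZeros ε).measurableSet,
    norm_inv, inv_inv, Fintype.card_fin]

/-- The Leray measure of the integral points of the cone is finite, and is the limit of the
normalized measures of the integral approximate zeros. -/
theorem lerayMeasure_ne_top_and_tendsto [IsUltrametricDist K] (hμ : ScalesByNorm μ)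
    (hμ1 : μ (Metric.closedBall 0 1) = 1)
    (hR : ∀ a : R, ‖algebraMap R K a‖ ≤ 1) (h : MinorBound K f e) (he : 0 < e)
    (hd : 1 ≤ d) (hf : ∀ i, (f i).IsHomogeneous d) (hδ : m * d < N + 1) {a : K} (ha : a ≠ 0)
    (ha1 : ‖a‖ < 1) (hgen : ∀ b : K, b ≠ 0 → ‖b‖ ≤ 1 → ∃ n : ℕ, ‖b‖ = ‖a‖ ^ n) :
    lerayMeasure f μ {x : coneSet K f | ‖x.1‖ ≤ 1} ≠ ∞ ∧
      Tendsto (fun r : ℕ => (Measure.pi (fun _ => μ) (nearZeros K f (‖a‖ ^ r))).toReal /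
        ‖a‖ ^ (r * m)) atTop (𝓝 (lerayMeasure f μ {x : coneSet K f | ‖x.1‖ ≤ 1}).toReal) := by
  have h0 : 0 < ‖a‖ := norm_pos_iff.2 ha
  set t : ℝ := ‖a‖ ^ (N + 1 - m * d) with ht
  have ht0 : 0 ≤ t := by positivity
  have ht1 : t < 1 := pow_lt_one₀ h0.le ha1 (by omega)
  -- Below `e` the minor bound applies; below `e²` Hensel's lemma applies.
  obtain ⟨r₀, hr₀⟩ : ∃ r₀ : ℕ, ∀ r, r₀ ≤ r → ‖a‖ ^ r < min e (e ^ 2) := by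
    have := (tendsto_pow_atTop_nhds_zero_of_lt_one h0.le ha1).eventually
      (gt_mem_nhds (show 0 < min e (e ^ 2) by positivity))
    exact eventually_atTop.1 this
  set p := lerayMeasure f μ {x : coneSet K f | ‖x.1‖ = 1} with hp
  have hβ : ∀ r, μ (Metric.closedBall 0 (‖a‖ ^ r)) ^ m = ENNReal.ofReal (‖a‖ ^ (r * m)) := by
    intro r
    rw [← norm_pow, hμ.measure_closedBall hμ1 (pow_ne_zero _ ha), norm_pow,
      ← ENNReal.ofReal_pow (by positivity), ← pow_mul]
  have hP : ∀ r, r₀ ≤ r → Measure.pi (fun _ => μ)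
      {x : Fin (N + 1) → K | ‖x‖ = 1 ∧ ‖fun i => aeval x (f i)‖ ≤ ‖a‖ ^ r} =
      ENNReal.ofReal (‖a‖ ^ (r * m)) * p := by
    intro r hr
    have := hr₀ r hr
    rw [lt_min_iff] at this
    rw [measure_norm_eq_one_near hμ hR h he (by positivity) this.1 this.2, hβ]
  -- A positive multiple of `p` is the volume of a subset of the unit ball.
  have hptop : p ≠ ∞ := by
    intro hptop
    have h1 := hP r₀ le_rfl
    rw [hptop, ENNReal.mul_top (ENNReal.ofReal_pos.2 (by positivity)).ne'] at h1
    refine measure_nearZeros_ne_top (μ := μ) (f := f) (‖a‖ ^ r₀) (top_unique ?_)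
    rw [← h1]
    exact measure_mono fun x hx => ⟨hx.1.le, hx.2⟩
  have hL : lerayMeasure f μ {x : coneSet K f | ‖x.1‖ ≤ 1} = (1 - ENNReal.ofReal t)⁻¹ * p :=
    lerayMeasure_norm_le_one hμ hd hf hδ ha ha1 hgen
  have ht1' : 1 - ENNReal.ofReal t = ENNReal.ofReal (1 - t) := by
    rw [ENNReal.ofReal_sub _ ht0, ENNReal.ofReal_one]
  have hLr : (lerayMeasure f μ {x : coneSet K f | ‖x.1‖ ≤ 1}).toReal = (1 - t)⁻¹ * p.toReal := by
    rw [hL, ENNReal.toReal_mul, ENNReal.toReal_inv, ht1', ENNReal.toReal_ofReal (by linarith)]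
  refine ⟨?_, ?_⟩
  · rw [hL, ht1']
    refine ENNReal.mul_ne_top (ENNReal.inv_ne_top.2 ?_) hptop
    simpa using ht1
  rw [hLr]
  refine tendsto_of_recurrence (r₀ := r₀) hd ht0 ht1 fun r hr => ?_
  have hle : ∀ b : K, ‖b‖ < 1 → ‖b‖ ≤ ‖a‖ := by
    intro b hb
    rcases eq_or_ne b 0 with rfl | hb0
    · simp
    obtain ⟨n, hn⟩ := hgen b hb0 hb.le
    rw [hn] at hb ⊢
    have : n ≠ 0 := by rintro rfl; simp at hb
    exact pow_le_of_le_one h0.le ha1.le this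
  -- Norms below 1 are at most `‖a‖`, so non-primitive points are divisible by `a`; division by `a`
  -- lowers the level by `d` because `f` has degree `d`.
  have hsplit : nearZeros K f (‖a‖ ^ (r + d)) =
      {x | ‖x‖ = 1 ∧ ‖fun i => aeval x (f i)‖ ≤ ‖a‖ ^ (r + d)} ∪
      {x | ‖x‖ ≤ ‖a‖ ∧ ‖fun i => aeval x (f i)‖ ≤ ‖a‖ ^ d * ‖a‖ ^ r} := by
    ext x
    simp only [nearZeros, Set.mem_ofPred_eq, Set.mem_union, ← or_and_right, ← pow_add, add_comm d]
    refine and_congr_left fun _ => ⟨fun hx => ?_,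
      fun hx => hx.elim le_of_eq fun h => h.trans ha1.le⟩
    refine hx.eq_or_lt.imp_right fun hx => (pi_norm_le_iff_of_nonneg h0.le).2 fun j => ?_
    exact hle _ ((norm_le_pi_norm x j).trans_lt hx)
  have hmeas : MeasurableSet
      {x : Fin (N + 1) → K | ‖x‖ ≤ ‖a‖ ∧ ‖fun i => aeval x (f i)‖ ≤ ‖a‖ ^ d * ‖a‖ ^ r} :=
    ((isClosed_le continuous_norm continuous_const).inter
      (isClosed_le (continuous_pi fun i => continuous_aeval_point (f i)).norm
        continuous_const)).measurableSet
  have hdisj : Disjoint {x : Fin (N + 1) → K | ‖x‖ = 1 ∧ ‖fun i => aeval x (f i)‖ ≤ ‖a‖ ^ (r + d)}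
      {x | ‖x‖ ≤ ‖a‖ ∧ ‖fun i => aeval x (f i)‖ ≤ ‖a‖ ^ d * ‖a‖ ^ r} :=
    Set.disjoint_left.2 fun x hx hx' => (hx'.1.trans_lt ha1).ne hx.1
  rw [hsplit, measure_union hdisj hmeas, hP _ (by omega), measure_nearZeros_smul hμ hf ha,
    ENNReal.toReal_add (ENNReal.mul_ne_top ENNReal.ofReal_ne_top hptop)
      (ENNReal.mul_ne_top ENNReal.ofReal_ne_top (measure_nearZeros_ne_top _)),
    ENNReal.toReal_mul, ENNReal.toReal_mul, ENNReal.toReal_ofReal (by positivity),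
    ENNReal.toReal_ofReal (by positivity)]
  have hpow : ‖a‖ ^ (N + 1) = t * ‖a‖ ^ (m * d) := by
    rw [ht, ← pow_add]; congr 1; omega
  have hpow2 : ‖a‖ ^ ((r + d) * m) = ‖a‖ ^ (r * m) * ‖a‖ ^ (m * d) := by
    rw [← pow_add]; congr 1; ring
  rw [hpow, hpow2]
  field_simp

end Density

/-! ### A uniform lower bound for the minors -/

section Nullstellensatz

open MvPolynomial

/-- Row rank equals column rank: a maximal independent family of columns has `m` members, and
listing them in increasing order gives `k`. -/
theorem exists_det_ne_zero_of_linearIndependent {L : Type*} [Field L] {m n : ℕ}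
    {v : Fin m → Fin n → L} (hv : LinearIndependent L v) :
    ∃ k : Fin m ↪o Fin n, (Matrix.of fun i j : Fin m => v i (k j)).det ≠ 0 := by
  classical
  have hrank : (Matrix.of v).rank = m := by
    have := LinearIndependent.rank_matrix (M := Matrix.of v) hv
    rwa [Fintype.card_fin] at this
  obtain ⟨κ, a, ha, hspan, hli⟩ := exists_linearIndependent' L (Matrix.of v).col
  have : Fintype κ := Fintype.ofInjective a ha
  have hcard : Fintype.card κ = m := by
    rw [← hrank, Matrix.rank_eq_finrank_span_cols, ← hspan, finrank_span_eq_card hli]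
  have hs : (Finset.univ.image a).card = m := by
    rw [Finset.card_image_of_injective _ ha, Finset.card_univ, hcard]
  let k : Fin m ↪o Fin n := (Finset.univ.image a).orderEmbOfFin hs
  have hk : ∀ j, ∃ b, a b = k j := fun j => by
    obtain ⟨b, -, hb⟩ := Finset.mem_image.1 (Finset.orderEmbOfFin_mem (Finset.univ.image a) hs j)
    exact ⟨b, hb⟩
  choose b hb using hk
  have hbi : Function.Injective b := fun i j hij => k.injective (by rw [← hb, ← hb, hij])
  have hli' : LinearIndependent L (Matrix.of fun i j : Fin m => v i (k j)).col := by
    have : (Matrix.of fun i j : Fin m => v i (k j)).col = ((Matrix.of v).col ∘ a) ∘ b := by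
      funext j i
      change v i (k j) = v i (a (b j))
      rw [hb]
    rw [this]
    exact hli.comp b hbi
  refine ⟨k, ?_⟩
  rw [Matrix.linearIndependent_cols_iff_isUnit, Matrix.isUnit_iff_isUnit_det] at hli'
  exact hli'.ne_zero

/-- Polynomials without common zeros other than the origin generate powers of the variables. -/
theorem exists_X_pow_mem_span {F σ : Type*} [Field F] [Finite σ] {S : Set (MvPolynomial σ F)}
    (hS : ∀ x : σ → AlgebraicClosure F, x ≠ 0 → ∃ s ∈ S, aeval x s ≠ 0) (j : σ) :
    ∃ n : ℕ, (X j : MvPolynomial σ F) ^ n ∈ Ideal.span S := by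
  have : (X j : MvPolynomial σ F) ∈ (Ideal.span S).radical := by
    rw [← vanishingIdeal_zeroLocus_eq_radical (K := AlgebraicClosure F), mem_vanishingIdeal_iff]
    intro x hx
    have hx0 : x = 0 := by
      by_contra h
      obtain ⟨s, hs, hs'⟩ := hS x h
      exact hs' (hx s (Ideal.subset_span hs))
    simp [hx0]
  exact this

variable {F K ι : Type*} [Field F] [NormedField K] [Algebra F K] [Fintype ι]

theorem exists_norm_aeval_le (p : MvPolynomial ι F) :
    ∃ C : ℝ, 0 ≤ C ∧ ∀ x : ι → K, ‖x‖ ≤ 1 → ‖aeval x p‖ ≤ C := by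
  induction p using MvPolynomial.induction_on with
  | C a => exact ⟨‖algebraMap F K a‖, norm_nonneg _, fun x _ => by simp⟩
  | add p q hp hq =>
    obtain ⟨C, hC, h⟩ := hp
    obtain ⟨C', hC', h'⟩ := hq
    refine ⟨C + C', add_nonneg hC hC', fun x hx => ?_⟩
    rw [map_add]
    exact (norm_add_le _ _).trans (add_le_add (h x hx) (h' x hx))
  | mul_X p i hp =>
    obtain ⟨C, hC, h⟩ := hp
    refine ⟨C, hC, fun x hx => ?_⟩
    rw [map_mul, norm_mul, aeval_X, ← mul_one C]
    exact mul_le_mul (h x hx) ((norm_le_pi_norm x i).trans hx) (norm_nonneg _) hC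

/-- The coefficients of a representation of `p` by elements of `S` are bounded on the unit ball, so
`p` is small wherever all of `S` is. The constant depends on neither `x` nor `B`. -/
theorem exists_norm_aeval_le_of_mem_span {S : Set (MvPolynomial ι F)} {p : MvPolynomial ι F}
    (hp : p ∈ Ideal.span S) : ∃ C : ℝ, 0 ≤ C ∧ ∀ x : ι → K, ‖x‖ ≤ 1 → ∀ B : ℝ, 0 ≤ B →
      (∀ s ∈ S, ‖aeval x s‖ ≤ B) → ‖aeval x p‖ ≤ C * B := by
  induction hp using Submodule.span_induction with
  | mem s hs => exact ⟨1, zero_le_one, fun x _ B _ h => by rw [one_mul]; exact h s hs⟩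
  | zero => exact ⟨0, le_rfl, fun x _ B _ _ => by simp⟩
  | add p q _ _ hp hq =>
    obtain ⟨C, hC, h⟩ := hp
    obtain ⟨C', hC', h'⟩ := hq
    refine ⟨C + C', add_nonneg hC hC', fun x hx B hB hS => ?_⟩
    rw [map_add, add_mul]
    exact (norm_add_le _ _).trans (add_le_add (h x hx B hB hS) (h' x hx B hB hS))
  | smul g p _ hp =>
    obtain ⟨C, hC, h⟩ := hp
    obtain ⟨C', hC', h'⟩ := exists_norm_aeval_le (K := K) g
    refine ⟨C' * C, mul_nonneg hC' hC, fun x hx B hB hS => ?_⟩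
    rw [smul_eq_mul, map_mul, norm_mul, mul_assoc]
    exact mul_le_mul (h' x hx) (h x hx B hB hS) (norm_nonneg _) hC'

/-- On a smooth complete intersection, the minors are uniformly bounded below near the integral
primitive points of the cone. -/
theorem IsSmoothCompleteIntersection.exists_minorBound {R : Type*} [CommRing R] [Algebra R F]
    [Algebra R K] [IsScalarTower R F K] {m N : ℕ} {f : Fin m → MvPolynomial (Fin (N + 1)) R}
    (hV : IsSmoothCompleteIntersection F f) : ∃ e : ℝ, 0 < e ∧ MinorBound K f e := by
  let S : Set (MvPolynomial (Fin (N + 1)) F) :=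
    (Set.range fun i => map (algebraMap R F) (f i)) ∪
      Set.range fun k => map (algebraMap R F) (minorPoly f k)
  have hS : ∀ x : Fin (N + 1) → AlgebraicClosure F, x ≠ 0 → ∃ s ∈ S, aeval x s ≠ 0 := by
    intro x hx
    by_cases h : ∀ i, aeval x (f i) = 0
    · obtain ⟨k, hk⟩ := exists_det_ne_zero_of_linearIndependent (hV x hx h)
      refine ⟨_, Or.inr ⟨k, rfl⟩, ?_⟩
      rw [aeval_map_algebraMap, aeval_minorPoly]
      exact hk
    · push Not at h
      obtain ⟨i, hi⟩ := h
      exact ⟨_, Or.inl ⟨i, rfl⟩, by rwa [aeval_map_algebraMap]⟩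
  choose n hn using exists_X_pow_mem_span hS
  choose C hC0 hC using fun j => exists_norm_aeval_le_of_mem_span (K := K) (hn j)
  have hsum : 0 ≤ ∑ j, C j := Finset.sum_nonneg fun j _ => hC0 j
  -- If all generators were at most this bound at a primitive `x`, a coordinate with `‖x j‖ = 1`
  -- would give `1 ≤ C j / (1 + ∑ C)`, which is absurd.
  refine ⟨(1 + ∑ j, C j)⁻¹, by positivity, fun x hx hfx => ?_⟩
  by_contra! hlt
  obtain ⟨j, -, hj⟩ := Finset.exists_max_image Finset.univ (fun i => ‖x i‖) ⟨0, Finset.mem_univ _⟩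
  have hxj : ‖x j‖ = 1 := by
    rw [← hx]
    exact le_antisymm (norm_le_pi_norm x j) ((pi_norm_le_iff_of_nonneg (norm_nonneg _)).2
      fun i => hj i (Finset.mem_univ _))
  have h1 := hC j x hx.le (1 + ∑ j, C j)⁻¹ (by positivity) (by
    rintro _ (⟨i, rfl⟩ | ⟨k, rfl⟩)
    · rw [aeval_map_algebraMap]
      exact (norm_le_pi_norm (fun i => aeval x (f i)) i).trans hfx.le
    · rw [aeval_map_algebraMap, aeval_minorPoly]
      exact (hlt k).le)
  rw [map_pow, aeval_X, norm_pow, hxj, one_pow, ← div_eq_mul_inv, le_div_iff₀ (by positivity)] at h1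
  have := Finset.single_le_sum (f := C) (fun j _ => hC0 j) (Finset.mem_univ j)
  linarith

end Nullstellensatz

/-! ### Counting congruence solutions by volume, and the normalization of Haar measure -/

section Count

open MvPolynomial
open scoped Pointwise

variable {K : Type*} [NontriviallyNormedField K] [IsUltrametricDist K] [ProperSpace K]
  [MeasurableSpace K] [BorelSpace K] [SecondCountableTopology K] {μ : Measure K}
  [μ.IsAddHaarMeasure] {O : ValuationSubring K}

/-- The measure of the integral approximate zeros, as the number of solutions of a congruence. -/
theorem measure_nearZeros_eq (hO : ∀ x : K, x ∈ O ↔ ‖x‖ ≤ 1) {R : Type*} [CommRing R]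
    [Algebra R K] [Algebra R O] [IsScalarTower R O K] {m N : ℕ}
    (f : Fin m → MvPolynomial (Fin (N + 1)) R) {I : Ideal O} [Finite (O ⧸ I)] {c : ℝ}
    (hc0 : 0 ≤ c) (hc1 : c ≤ 1) (hI : ∀ x : O, x ∈ I ↔ ‖(x : K)‖ ≤ c) :
    Measure.pi (fun _ => μ) (nearZeros K f c) =
      Nat.card {x : Fin (N + 1) → O ⧸ I // ∀ i, aeval x (f i) = 0} *
        μ (Metric.closedBall 0 c) ^ (N + 1) := by
  classical
  let T := {x : Fin (N + 1) → O ⧸ I // ∀ i, aeval x (f i) = 0}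
  let s : T → Fin (N + 1) → K := fun x j => ((x.1 j).out : O)
  have hmk : ∀ (w : Fin (N + 1) → O) (p : MvPolynomial (Fin (N + 1)) R),
      aeval (fun j => Ideal.Quotient.mk I (w j)) p = Ideal.Quotient.mk I (aeval w p) := fun w p =>
    aeval_algebraMap_apply (O ⧸ I) w p
  have hcoe : ∀ (w : Fin (N + 1) → O) (p : MvPolynomial (Fin (N + 1)) R),
      aeval (fun j => (w j : K)) p = (aeval w p : O) := fun w p =>
    aeval_algebraMap_apply K w p
  have hiff : ∀ (w : Fin (N + 1) → O), (∀ i, aeval (fun j => Ideal.Quotient.mk I (w j)) (f i) = 0) ↔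
      ‖fun i => aeval (fun j => (w j : K)) (f i)‖ ≤ c := fun w => by
    rw [pi_norm_le_iff_of_nonneg hc0]
    refine forall_congr' fun i => ?_
    rw [hmk, hcoe, Ideal.Quotient.eq_zero_iff_mem, hI]
  have hsub : ∀ u v : O, Ideal.Quotient.mk I u = Ideal.Quotient.mk I v ↔ ‖(u : K) - v‖ ≤ c :=
    fun u v => by rw [Ideal.Quotient.mk_eq_mk_iff_sub_mem, hI]; rfl
  have hout : ∀ q : O ⧸ I, Ideal.Quotient.mk I q.out = q := fun q => Quotient.out_eq' q
  -- Cosets of `I` are balls of radius `c`, and the condition `‖f‖ ≤ c` depends only on the coset,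
  -- where it says that `f` vanishes modulo `I`.
  have key : nearZeros K f c = ⋃ x : T, Metric.closedBall (s x) c := by
    ext u
    simp only [Set.mem_iUnion, mem_closedBall_iff_norm]
    constructor
    · rintro ⟨hu1, hu2⟩
      let w : Fin (N + 1) → O := fun j => ⟨u j, (hO _).2 ((norm_le_pi_norm u j).trans hu1)⟩
      refine ⟨⟨fun j => Ideal.Quotient.mk I (w j), (hiff w).2 hu2⟩, ?_⟩
      refine (pi_norm_le_iff_of_nonneg hc0).2 fun j => ?_
      exact (hsub (w j) _).1 (hout _).symm
    · rintro ⟨x, hx⟩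
      have hu1 : ‖u‖ ≤ 1 := by
        have h1 : ‖s x‖ ≤ 1 := (pi_norm_le_iff_of_nonneg zero_le_one).2 fun j =>
          (hO _).1 (x.1 j).out.2
        have := norm_add_le_of_le_of_le (hx.trans hc1) h1
        rwa [sub_add_cancel] at this
      let w : Fin (N + 1) → O := fun j => ⟨u j, (hO _).2 ((norm_le_pi_norm u j).trans hu1)⟩
      have hw : (fun j => Ideal.Quotient.mk I (w j)) = x.1 := funext fun j => by
        rw [← hout (x.1 j), hsub]
        exact (norm_le_pi_norm (u - s x) j).trans hx
      refine ⟨hu1, (hiff w).1 ?_⟩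
      rw [hw]
      exact x.2
  have hdisj : Pairwise (Function.onFun Disjoint fun x : T => Metric.closedBall (s x) c) := by
    intro x y hne
    refine Set.disjoint_left.2 fun u hu hu' => hne (Subtype.ext (funext fun j => ?_))
    rw [mem_closedBall_iff_norm] at hu hu'
    rw [← hout (x.1 j), ← hout (y.1 j), hsub]
    have := norm_sub_le_of_le_of_le ((norm_le_pi_norm (u - s y) j).trans hu')
      ((norm_le_pi_norm (u - s x) j).trans hu)
    have h2 : (u - s y) j - (u - s x) j = s x j - s y j := by simp
    rwa [h2] at this
  have : Fintype T := Fintype.ofFinite T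
  rw [key, measure_iUnion hdisj fun x => Metric.isClosed_closedBall.measurableSet, tsum_fintype]
  have hball : ∀ x : T, Measure.pi (fun _ => μ) (Metric.closedBall (s x) c) =
      μ (Metric.closedBall 0 c) ^ (N + 1) := by
    intro x
    have : Metric.closedBall (s x) c = (· + -s x) ⁻¹' Metric.closedBall 0 c := by
      ext u; simp [dist_eq_norm, sub_eq_add_neg]
    rw [this, measure_preimage_add_right, pi_closedBall μ hc0, Fintype.card_fin]
  simp only [hball, Finset.sum_const, nsmul_eq_mul, Finset.card_univ, Nat.card_eq_fintype_card]
  rfl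

/-- The counting formula for an empty system in one variable, whose approximate zeros fill the unit
ball. -/
theorem measure_closedBall_mul_card (hO : ∀ x : K, x ∈ O ↔ ‖x‖ ≤ 1) {I : Ideal O}
    [Finite (O ⧸ I)] {c : ℝ} (hc0 : 0 ≤ c) (hc1 : c ≤ 1) (hI : ∀ x : O, x ∈ I ↔ ‖(x : K)‖ ≤ c) :
    Nat.card (O ⧸ I) * μ (Metric.closedBall 0 c) = μ (Metric.closedBall 0 1) := by
  have h1 := measure_nearZeros_eq (μ := μ) hO (fun i : Fin 0 => (i.elim0 : MvPolynomial (Fin 1) O))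
    hc0 hc1 hI
  have h2 : nearZeros K (fun i : Fin 0 => (i.elim0 : MvPolynomial (Fin 1) O)) c =
      Metric.closedBall 0 1 := by
    ext x
    have h3 : (fun i : Fin 0 => aeval x (i.elim0 : MvPolynomial (Fin 1) O)) = 0 :=
      Subsingleton.elim _ _
    simp only [nearZeros, Set.mem_ofPred_eq, h3, norm_zero, hc0, and_true, mem_closedBall_zero_iff]
  have h4 : Nat.card {x : Fin 1 → O ⧸ I //
      ∀ i : Fin 0, aeval x (i.elim0 : MvPolynomial (Fin 1) O) = 0} = Nat.card (O ⧸ I) :=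
    Nat.card_congr ((Equiv.subtypeUnivEquiv fun x i => i.elim0).trans (Equiv.funUnique _ _))
  rw [h2, pi_closedBall μ zero_le_one, h4] at h1
  simpa using h1.symm

/-- Haar measure scales by the absolute value, when the latter is normalized. -/
theorem scalesByNorm (hO : ∀ x : K, x ∈ O ↔ ‖x‖ ≤ 1) {I : Ideal O} [Finite (O ⧸ I)]
    {a : K} (ha0 : a ≠ 0) (ha1 : ‖a‖ ≤ 1) (hI : ∀ x : O, x ∈ I ↔ ‖(x : K)‖ ≤ ‖a‖)
    (ha : ‖a‖ = (Nat.card (O ⧸ I) : ℝ)⁻¹)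
    (hgen : ∀ b : K, b ≠ 0 → ‖b‖ ≤ 1 → ∃ n : ℕ, ‖b‖ = ‖a‖ ^ n) : ScalesByNorm μ := by
  have hpos : μ (Metric.closedBall 0 1) ≠ 0 :=
    (Metric.measure_closedBall_pos μ 0 zero_lt_one).ne'
  have htop : μ (Metric.closedBall (0 : K) 1) ≠ ∞ := measure_closedBall_lt_top.ne
  have hsmul : ∀ u : Kˣ, u • Metric.closedBall (0 : K) 1 = Metric.closedBall 0 ‖(u : K)‖ := by
    intro u
    ext x
    rw [Set.mem_smul_set_iff_inv_smul_mem, Units.smul_def, mem_closedBall_zero_iff,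
      mem_closedBall_zero_iff, norm_smul, Units.val_inv_eq_inv_val, norm_inv,
      inv_mul_le_iff₀ (norm_pos_iff.2 u.ne_zero), mul_one]
  -- The Haar modulus is multiplicative, so it suffices to compare it with the norm on elements of
  -- norm one, which preserve the unit ball, and on `a`, which maps the unit ball onto a ball of
  -- index `#(O ⧸ I)`.
  have hone : ∀ u : Kˣ, ‖(u : K)‖ = 1 → distribHaarChar K u = 1 := by
    intro u hu
    refine distribHaarChar_eq_of_measure_smul_eq_mul hpos htop (μ := μ) ?_
    rw [hsmul, hu, ENNReal.coe_one, one_mul]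
  have hchar_a : distribHaarChar K (Units.mk0 a ha0) = ‖a‖₊ := by
    refine distribHaarChar_eq_of_measure_smul_eq_mul hpos htop (μ := μ) ?_
    have hq : (Nat.card (O ⧸ I) : ℝ≥0∞) ≠ 0 := by
      exact_mod_cast Nat.card_pos.ne'
    rw [hsmul, Units.val_mk0, ← measure_closedBall_mul_card hO (norm_nonneg a) ha1 hI,
      ← mul_assoc]
    have : (‖a‖₊ : ℝ≥0∞) = (Nat.card (O ⧸ I) : ℝ≥0∞)⁻¹ := by
      rw [show (‖a‖₊ : ℝ≥0∞) = ENNReal.ofReal ‖a‖ from (ofReal_norm a).symm, ha,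
        ENNReal.ofReal_inv_of_pos (by exact_mod_cast Nat.card_pos), ENNReal.ofReal_natCast]
    rw [this, ENNReal.inv_mul_cancel hq (ENNReal.natCast_ne_top _), one_mul]
  have hle : ∀ u : Kˣ, ‖(u : K)‖ ≤ 1 → distribHaarChar K u = ‖(u : K)‖₊ := by
    intro u hu
    obtain ⟨n, hn⟩ := hgen u u.ne_zero hu
    have h1 : u = Units.mk0 a ha0 ^ n * ((Units.mk0 a ha0 ^ n)⁻¹ * u) := by group
    have h2 : distribHaarChar K ((Units.mk0 a ha0 ^ n)⁻¹ * u) = 1 := by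
      refine hone _ ?_
      rw [Units.val_mul, norm_mul, hn, Units.val_inv_eq_inv_val, Units.val_pow_eq_pow_val,
        Units.val_mk0, norm_inv, norm_pow, inv_mul_cancel₀]
      exact pow_ne_zero _ (norm_ne_zero_iff.2 ha0)
    rw [h1, map_mul, h2, map_pow, hchar_a, mul_one, ← h1]
    exact NNReal.eq hn.symm
  have hall : ∀ u : Kˣ, distribHaarChar K u = ‖(u : K)‖₊ := by
    intro u
    rcases le_total ‖(u : K)‖ 1 with h | h
    · exact hle u h
    · have := hle u⁻¹ (by rw [Units.val_inv_eq_inv_val, norm_inv]; exact inv_le_one_of_one_le₀ h)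
      rwa [map_inv, Units.val_inv_eq_inv_val, nnnorm_inv, inv_inj] at this
  intro b hb s
  have h1 : (b * ·) ⁻¹' s = (Units.mk0 b hb)⁻¹ • s := by
    ext x
    rw [Set.mem_smul_set_iff_inv_smul_mem, inv_inv]
    rfl
  rw [h1, ← distribHaarChar_mul, hall, Units.val_inv_eq_inv_val, Units.val_mk0]
  congr 1
  rw [← norm_inv, ofReal_norm]
  rfl

end Count

/-! ### The completion at a finite place: norm, maximal ideal, residue field -/

section AdicCompletion

open IsDedekindDomain HeightOneSpectrum NumberField NumberField.HeightOneSpectrum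

variable {F : Type*} [Field F] [NumberField F] (v : HeightOneSpectrum (𝓞 F))

theorem norm_eq_zpow_log {x : v.adicCompletion F} (hx : x ≠ 0) :
    ‖x‖ = (Ideal.absNorm v.asIdeal : ℝ) ^ WithZero.log (Valued.v x) := by
  have h0 : Valued.v x ≠ 0 := (Valuation.ne_zero_iff _).2 hx
  rw [FinitePlace.norm_def, WithZeroMulInt.toNNReal_neg_apply _ h0]
  push_cast
  congr 1
  conv_rhs => rw [← WithZero.coe_unzero h0]
  rfl

theorem one_lt_absNorm_real : 1 < (Ideal.absNorm v.asIdeal : ℝ) := by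
  exact_mod_cast one_lt_absNorm v

theorem mem_adicCompletionIntegers_iff_norm_le_one (x : v.adicCompletion F) :
    x ∈ v.adicCompletionIntegers F ↔ ‖x‖ ≤ 1 := by
  rw [mem_adicCompletionIntegers, FinitePlace.norm_def, NNReal.coe_le_one]
  exact (WithZeroMulInt.toNNReal_le_one_iff (one_lt_absNorm_nnreal v)).symm

theorem valued_lt_one_iff_norm_lt_one (x : v.adicCompletion F) : Valued.v x < 1 ↔ ‖x‖ < 1 := by
  rw [FinitePlace.norm_def, NNReal.coe_lt_one]
  exact (WithZeroMulInt.toNNReal_lt_one_iff (one_lt_absNorm_nnreal v)).symm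

theorem exists_norm_eq_absNorm_inv :
    ∃ a : v.adicCompletion F, a ≠ 0 ∧ ‖a‖ = (Ideal.absNorm v.asIdeal : ℝ)⁻¹ := by
  obtain ⟨a, ha⟩ := valuedAdicCompletion_surjective F v (WithZero.exp (-1))
  have h0 : a ≠ 0 := by
    rintro rfl
    rw [map_zero] at ha
    exact WithZero.exp_ne_zero ha.symm
  exact ⟨a, h0, by rw [norm_eq_zpow_log v h0, ha, WithZero.log_exp, zpow_neg_one]⟩

theorem exists_norm_eq_pow {b : v.adicCompletion F} (hb : b ≠ 0) (hb1 : ‖b‖ ≤ 1) :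
    ∃ n : ℕ, ‖b‖ = ((Ideal.absNorm v.asIdeal : ℝ)⁻¹) ^ n := by
  rw [norm_eq_zpow_log v hb] at hb1 ⊢
  rw [zpow_le_one_iff_right₀ (one_lt_absNorm_real v)] at hb1
  obtain ⟨n, hn⟩ := Int.eq_ofNat_of_zero_le (neg_nonneg.2 hb1)
  exact ⟨n, by rw [← neg_neg (WithZero.log _), hn, zpow_neg, zpow_natCast, inv_pow]⟩

theorem mem_maximalIdeal_iff (x : v.adicCompletionIntegers F) :
    x ∈ IsLocalRing.maximalIdeal (v.adicCompletionIntegers F) ↔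
      ‖(x : v.adicCompletion F)‖ < 1 := by
  rw [IsLocalRing.mem_maximalIdeal, mem_nonunits_iff,
    adicCompletionIntegers.isUnit_iff_valued_eq_one, ← valued_lt_one_iff_norm_lt_one]
  exact ((show Valued.v x.1 ≤ 1 from x.2).lt_iff_ne).symm

theorem mem_span_singleton_iff {c : v.adicCompletionIntegers F}
    (hc : (c : v.adicCompletion F) ≠ 0) (x : v.adicCompletionIntegers F) :
    x ∈ Ideal.span {c} ↔ ‖(x : v.adicCompletion F)‖ ≤ ‖(c : v.adicCompletion F)‖ := by
  rw [Ideal.mem_span_singleton]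
  constructor
  · rintro ⟨y, rfl⟩
    have h1 := (mem_adicCompletionIntegers_iff_norm_le_one v y).1 y.2
    have h2 : ((c * y : v.adicCompletionIntegers F) : v.adicCompletion F) = c * y := rfl
    rw [h2, norm_mul]
    exact mul_le_of_le_one_right (norm_nonneg _) h1
  · intro h
    refine ⟨⟨(c : v.adicCompletion F)⁻¹ * x, ?_⟩, Subtype.ext ?_⟩
    · rw [mem_adicCompletionIntegers_iff_norm_le_one, norm_mul, norm_inv,
        inv_mul_le_iff₀ (norm_pos_iff.2 hc), mul_one]
      exact h
    · exact (mul_inv_cancel_left₀ hc _).symm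

theorem mem_maximalIdeal_pow_iff {a : v.adicCompletion F}
    (ha : ‖a‖ = (Ideal.absNorm v.asIdeal : ℝ)⁻¹) (r : ℕ) (x : v.adicCompletionIntegers F) :
    x ∈ IsLocalRing.maximalIdeal (v.adicCompletionIntegers F) ^ r ↔
      ‖(x : v.adicCompletion F)‖ ≤ ‖a‖ ^ r := by
  have hq := one_lt_absNorm_real v
  have ha1 : ‖a‖ < 1 := ha ▸ inv_lt_one_of_one_lt₀ hq
  have ha0 : a ≠ 0 := norm_pos_iff.1 (ha ▸ by positivity)
  let c : v.adicCompletionIntegers F :=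
    ⟨a, (mem_adicCompletionIntegers_iff_norm_le_one v a).2 ha1.le⟩
  have hm : IsLocalRing.maximalIdeal (v.adicCompletionIntegers F) = Ideal.span {c} := by
    ext y
    rw [mem_maximalIdeal_iff, mem_span_singleton_iff v (c := c) ha0]
    refine ⟨fun h => ?_, fun h => h.trans_lt ha1⟩
    rcases eq_or_ne (y : v.adicCompletion F) 0 with h0 | h0
    · rw [h0, norm_zero]; exact norm_nonneg _
    obtain ⟨n, hn⟩ := exists_norm_eq_pow v h0 h.le
    rw [hn, ← ha] at h ⊢
    have : n ≠ 0 := by rintro rfl; simp at h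
    exact pow_le_of_le_one (norm_nonneg _) ha1.le this
  have h2 : ((c ^ r : v.adicCompletionIntegers F) : v.adicCompletion F) = a ^ r := rfl
  rw [hm, Ideal.span_singleton_pow, mem_span_singleton_iff v (by rw [h2]; exact pow_ne_zero _ ha0),
    h2, norm_pow]

/-- Approximate an integral element of the completion within distance less than 1 by an element of
`F`. The latter is then integral at `v`, so it is in turn congruent to an algebraic integer. -/
theorem residue_comp_algebraMap_surjective :
    Function.Surjective ((IsLocalRing.residue (v.adicCompletionIntegers F)).comp
      (algebraMap (𝓞 F) (v.adicCompletionIntegers F))) := by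
  intro y
  obtain ⟨x, rfl⟩ := IsLocalRing.residue_surjective y
  obtain ⟨k, hk⟩ := (denseRange_algebraMap F v).exists_mem_open
    (Metric.isOpen_ball (x := (x : v.adicCompletion F)) (ε := 1)) ⟨_, Metric.mem_ball_self one_pos⟩
  rw [mem_ball_iff_norm, ← valued_lt_one_iff_norm_lt_one] at hk
  have hk1 : v.valuation F k ≤ 1 := by
    rw [← valuedAdicCompletion_eq_valuation']
    have := Valued.v.map_add_le hk.le x.2
    rwa [sub_add_cancel] at this
  obtain ⟨r, hr⟩ := exists_valuation_sub_lt_of_integer v hk1 1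
  refine ⟨r, ?_⟩
  rw [RingHom.comp_apply, ← sub_eq_zero, ← map_sub, IsLocalRing.residue_eq_zero_iff,
    mem_maximalIdeal_iff, ← valued_lt_one_iff_norm_lt_one]
  rw [← valuedAdicCompletion_eq_valuation', Units.val_one] at hr
  have h1 := Valued.v.map_add_lt hr hk
  convert h1 using 2
  have : ((algebraMap (𝓞 F) F r - k : F) : v.adicCompletion F) =
    algebraMap F (v.adicCompletion F) (algebraMap (𝓞 F) F r) -
      algebraMap F (v.adicCompletion F) k :=
    map_sub (algebraMap F (v.adicCompletion F)) _ _
  rw [this, sub_add_sub_cancel]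
  rfl

theorem ker_residue_comp_algebraMap :
    RingHom.ker ((IsLocalRing.residue (v.adicCompletionIntegers F)).comp
      (algebraMap (𝓞 F) (v.adicCompletionIntegers F))) = v.asIdeal := by
  ext r
  rw [RingHom.mem_ker, RingHom.comp_apply, IsLocalRing.residue_eq_zero_iff, mem_maximalIdeal_iff,
    ← valued_lt_one_iff_norm_lt_one, ← valuation_lt_one_iff_mem (K := F),
    ← valuedAdicCompletion_eq_valuation']
  rfl

/-- The residue field of the completion at `v` is that of `v`. -/
noncomputable def quotientEquivResidueField : (𝓞 F ⧸ v.asIdeal) ≃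
    IsLocalRing.ResidueField (v.adicCompletionIntegers F) :=
  (Ideal.quotEquivOfEq (ker_residue_comp_algebraMap v).symm).toEquiv.trans
    (RingHom.quotientKerEquivOfSurjective (residue_comp_algebraMap_surjective v)).toEquiv

theorem card_residueField :
    Nat.card (IsLocalRing.ResidueField (v.adicCompletionIntegers F)) =
      Ideal.absNorm v.asIdeal := by
  rw [Ideal.absNorm_apply, Submodule.cardQuot_apply]
  exact (Nat.card_congr (quotientEquivResidueField v)).symm

theorem finite_residueField : Finite (IsLocalRing.ResidueField (v.adicCompletionIntegers F)) := by
  have : Finite (𝓞 F ⧸ v.asIdeal) := Ideal.finiteQuotientOfFreeOfNeBot _ v.ne_bot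
  exact Finite.of_equiv _ (quotientEquivResidueField v)

theorem finite_quotient_maximalIdeal_pow (r : ℕ) :
    Finite (v.adicCompletionIntegers F ⧸
      IsLocalRing.maximalIdeal (v.adicCompletionIntegers F) ^ r) := by
  have : Finite (v.adicCompletionIntegers F ⧸
      IsLocalRing.maximalIdeal (v.adicCompletionIntegers F)) := finite_residueField v
  exact Ideal.finite_quotient_pow (IsNoetherian.noetherian _) r

open scoped Valued in
theorem isUltrametricDist_adicCompletion : IsUltrametricDist (v.adicCompletion F) := inferInstance

open scoped Valued in
theorem properSpace_adicCompletion : ProperSpace (v.adicCompletion F) :=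
  Valued.integer.properSpace_iff_completeSpace_and_isDiscreteValuationRing_integer_and_finite_residueField.2
    ⟨inferInstance, inferInstanceAs (IsDiscreteValuationRing (v.adicCompletionIntegers F)),
      finite_residueField v⟩

theorem norm_algebraMap_le_one (r : 𝓞 F) : ‖algebraMap (𝓞 F) (v.adicCompletion F) r‖ ≤ 1 :=
  (mem_adicCompletionIntegers_iff_norm_le_one v _).1 (coe_algebraMap_mem (𝓞 F) F v r)

end AdicCompletion

end LerayDensity

/-! ### Specialization to the completion at `v` -/

open LerayDensity in
theorem mainTheorem1 {F : Type*} [Field F] [NumberField F]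
    (v : IsDedekindDomain.HeightOneSpectrum (𝓞 F))
    [MeasurableSpace (v.adicCompletion F)] [BorelSpace (v.adicCompletion F)]
    (μ : Measure (v.adicCompletion F)) [μ.IsAddHaarMeasure]
    (hμ : μ (v.adicCompletionIntegers F : Set (v.adicCompletion F)) = 1)
    {m N d : ℕ} (hd : 1 ≤ d)
    (f : Fin m → MvPolynomial (Fin (N + 1)) (𝓞 F))
    (hf : ∀ i, (f i).IsHomogeneous d)
    (hV : LerayDensity.IsSmoothCompleteIntersection F f)
    (hδ : m * d < N + 1) :
    LerayDensity.lerayMeasure f μ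
        {x : LerayDensity.coneSet (v.adicCompletion F) f |
          ∀ j, x.1 j ∈ v.adicCompletionIntegers F} ≠ ∞ ∧
      Tendsto (fun r : ℕ =>
          (LerayDensity.solutionCount (v.adicCompletionIntegers F) f r : ℝ) /
            (Nat.card (IsLocalRing.ResidueField (v.adicCompletionIntegers F)) : ℝ)
              ^ (r * (N + 1 - m)))
        atTop
        (𝓝 (LerayDensity.lerayMeasure f μ
          {x : LerayDensity.coneSet (v.adicCompletion F) f |
            ∀ j, x.1 j ∈ v.adicCompletionIntegers F}).toReal) := by
  let : NontriviallyNormedField (v.adicCompletion F) :=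
    Valued.toNontriviallyNormedField _ (WithZero (Multiplicative ℤ))
  have : IsUltrametricDist (v.adicCompletion F) := isUltrametricDist_adicCompletion v
  have := properSpace_adicCompletion v
  have : IsScalarTower (𝓞 F) (v.adicCompletionIntegers F) (v.adicCompletion F) :=
    IsScalarTower.of_algebraMap_eq fun _ => rfl
  have hO := mem_adicCompletionIntegers_iff_norm_le_one v
  have hq := one_lt_absNorm_real v
  obtain ⟨a, ha0, ha⟩ := exists_norm_eq_absNorm_inv v
  have ha1 : ‖a‖ < 1 := ha ▸ inv_lt_one_of_one_lt₀ hq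
  have hgen : ∀ b : v.adicCompletion F, b ≠ 0 → ‖b‖ ≤ 1 → ∃ n : ℕ, ‖b‖ = ‖a‖ ^ n :=
    fun b hb hb1 => ha ▸ exists_norm_eq_pow v hb hb1
  have hfin := finite_quotient_maximalIdeal_pow v
  have : Finite (v.adicCompletionIntegers F ⧸
    IsLocalRing.maximalIdeal (v.adicCompletionIntegers F)) := finite_residueField v
  have hI := mem_maximalIdeal_pow_iff v ha
  have hscale : ScalesByNorm μ := by
    refine scalesByNorm (I := IsLocalRing.maximalIdeal (v.adicCompletionIntegers F)) hO ha0 ha1.le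
      (fun x => by simpa using hI 1 x) ?_ hgen
    rw [ha, ← card_residueField]
    rfl
  have hμ1 : μ (Metric.closedBall 0 1) = 1 := by
    rw [← hμ]
    congr 1
    ext x
    rw [mem_closedBall_zero_iff, SetLike.mem_coe, hO]
  obtain ⟨e, he, hme⟩ := hV.exists_minorBound (K := v.adicCompletion F)
  have hmain := lerayMeasure_ne_top_and_tendsto hscale hμ1 (norm_algebraMap_le_one v) hme he hd hf
    hδ ha0 ha1 hgen
  have hset : {x : coneSet (v.adicCompletion F) f | ∀ j, x.1 j ∈ v.adicCompletionIntegers F} =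
      {x : coneSet (v.adicCompletion F) f | ‖x.1‖ ≤ 1} := by
    ext x
    simp only [Set.mem_ofPred_eq, hO, pi_norm_le_iff_of_nonneg zero_le_one]
  rw [hset]
  refine ⟨hmain.1, hmain.2.congr fun r => ?_⟩
  -- Makes the subtraction in `N + 1 - m` genuine, so that the volume factor `q^{-r(N+1)}` divided
  -- by `q^{-rm}` is `q^{-r(N+1-m)}`.
  have hmN : m ≤ N + 1 := (Nat.le_mul_of_pos_right m hd).trans hδ.le
  rw [measure_nearZeros_eq hO f (I := IsLocalRing.maximalIdeal (v.adicCompletionIntegers F) ^ r)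
    (by positivity) (pow_le_one₀ (norm_nonneg _) ha1.le) (hI r), ← norm_pow,
    hscale.measure_closedBall hμ1 (pow_ne_zero _ ha0), ENNReal.toReal_mul, ENNReal.toReal_natCast,
    ENNReal.toReal_pow, ENNReal.toReal_ofReal (norm_nonneg _), norm_pow, card_residueField, ha,
    ← pow_mul, mul_div_assoc]
  rw [div_eq_mul_inv (solutionCount _ f r : ℝ)]
  congr 1
  rw [div_eq_iff (by positivity), ← inv_pow, ← pow_add, ← mul_add, Nat.sub_add_cancel hmN]
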